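/- Let $M_0,M_1\ge 1$ be integers and let $P$ be a stochastic matrix of M/G/1 type, i.e. a transition matrix on $\mathbb S=\{(0,i):1\le i\le M_0\}\cup\{(k,i):k\ge1,\ 1\le i\le M_1\}$ ($k$ is called the level) with level blocks $$P(0;0)=B(0),\quad P(0;l)=B(l)\ (l\ge1),\quad P(1;0)=B(-1),\quad P(k;l)=A(l-k)\ (k,l\ge1,\ l\ge k-1),$$ and all other blocks equal to zero. Let $e$ denote a column vector of ones. Assumption 1: (i) $P$ is irreducible; (ii) $A:=\sum_{k\ge-1}A(k)$ is an irreducible stochastic matrix; (iii) $\sum_{k\ge1}kB(k)e<\infty$; (iv) $\overline m_A:=\sum_{k\ge-1}kA(k)e$ is finite and $\sigma:=\varpi\,\overline m_A<0$, where $\varpi$ is the stationary distribution of $A$. Assumption 2: put $\overline A(k)=\sum_{l\ge k+1}A(l)$ and $\overline{\overline A}(k)=\sum_{l\ge k+1}\overline A(l)$, and define $\overline B$, $\overline{\overline B}$ in the same way from $B$. There is a probability distribution function $F$ on $\{0,1,2,\dots\}$ which is long-tailed (that is, $\overline F:=1-F$ is positive everywhere and $\overline F(k+n)/\overline F(k)\to1$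 as $k\to\infty$ for every $n\ge0$) such that $$\lim_{N\to\infty}\frac{\overline{\overline A}(N)e}{\overline F(N)}=c_A,\qquad \lim_{N\to\infty}\frac{\overline{\overline B}(N)e}{\overline F(N)}=c_B,$$ where $c_A,c_B\ge0$ are finite vectors which are not both zero. For $N\ge1$ let $P^{(N)}$ be the level-increment truncation of $P$: the matrix of M/G/1 type with blocks $A^{(N)}(k)=A(k)$ for $k\le N-1$, $A^{(N)}(N)=\overline A(N-1)$, $A^{(N)}(k)=0$ for $k>N$, and $B^{(N)}(k)$ defined in the same way from $B$. Theorem. Let Assumptions 1 and 2 hold. Then $P$ has a unique stationary distribution $\pi=(\pi(0),\pi(1),\dots)$; $P^{(N)}$ has a stationary distribution for every $N\ge1$, and it is unique for all sufficiently large $N$. For every choice of stationary distributions $\pi^{(N)}$ of $P^{(N)}$, $N\ge1$, and every level $k\ge0$, $$\lim_{N\to\infty}\frac{\pi^{(N)}(k)-\pi(k)}{\overline F(N)}=\frac{\pi(0)c_B+\overline\pi(0)c_A}{-\sigma}\,\pi(k)>0\quad\text{(entrywise)},\qquad \overline\pi(0)=\sum_{l\ge1}\pi(l),$$ and thus $$\lim_{N\to\infty}\frac1{\overline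 F(N)}\left\|\frac{\pi^{(N)}(k)-\pi(k)}{\pi(k)e}\right\|=\frac{\pi(0)c_B+\overline\pi(0)c_A}{-\sigma}>0,$$ where $\|x\|=\sum_i|x_i|$ is the total variation norm; the last limit does not depend on $k$. -/

import Mathlib

open Filter Topology Matrix

noncomputable section

namespace MG1

/-! ### Block data of a chain of M/G/1 type and its transition matrix -/

/-- The blocks of a transition matrix of M/G/1 type with `M₀` phases in level `0` and `M₁` phases in
every level `k ≥ 1`. -/
structure Blocks (M₀ M₁ : ℕ) where
  /-- the block `A(-1)` -/
  Am1 : Matrix (Fin M₁) (Fin M₁) ℝ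
  /-- the blocks `A(n)`, `n ≥ 0` -/
  A : ℕ → Matrix (Fin M₁) (Fin M₁) ℝ
  /-- the block `B(-1)` -/
  Bm1 : Matrix (Fin M₁) (Fin M₀) ℝ
  /-- the block `B(0)` -/
  B0 : Matrix (Fin M₀) (Fin M₀) ℝ
  /-- the blocks `B(n)`, `n ≥ 1`; the entry at `n = 0` is never used, since `B(0)` is `B0` -/
  B : ℕ → Matrix (Fin M₀) (Fin M₁) ℝ

/-- The set of phases of level `k`. -/
def Phase (M₀ M₁ : ℕ) : ℕ → Type
  | 0 => Fin M₀
  | _ + 1 => Fin M₁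

instance (M₀ M₁ : ℕ) : (k : ℕ) → Fintype (Phase M₀ M₁ k)
  | 0 => inferInstanceAs (Fintype (Fin M₀))
  | _ + 1 => inferInstanceAs (Fintype (Fin M₁))

/-- The state space: pairs `⟨k, i⟩` of a level `k` and a phase `i` of that level. -/
abbrev State (M₀ M₁ : ℕ) : Type := Σ k : ℕ, Phase M₀ M₁ k

variable {M₀ M₁ : ℕ}

/-- The upper block-Hessenberg transition matrix `P` built from the blocks. -/
def Blocks.P (D : Blocks M₀ M₁) : Matrix (State M₀ M₁) (State M₀ M₁) ℝ
  | ⟨0, i⟩, ⟨0, j⟩ => D.B0 i j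
  | ⟨0, i⟩, ⟨l + 1, j⟩ => D.B (l + 1) i j
  | ⟨1, i⟩, ⟨0, j⟩ => D.Bm1 i j
  | ⟨_ + 2, _⟩, ⟨0, _⟩ => 0
  | ⟨k + 1, i⟩, ⟨l + 1, j⟩ =>
      if k ≤ l then D.A (l - k) i j else if l + 1 = k then D.Am1 i j else 0

/-! ### Stochastic matrices and stationary distributions on countable state spaces -/

/-- Entrywise nonnegative with all row sums equal to one. -/
def IsStochastic {S : Type*} (P : Matrix S S ℝ) : Prop :=
  (∀ x y, 0 ≤ P x y) ∧ ∀ x, HasSum (fun y => P x y) 1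

/-- `p` is a probability vector with `p P = p`. -/
structure IsStationary {S : Type*} (P : Matrix S S ℝ) (p : S → ℝ) : Prop where
  nonneg : ∀ x, 0 ≤ p x
  hasSum_one : HasSum p 1
  invariant : ∀ y, HasSum (fun x => p x * P x y) (p y)

/-! ### Sums and tail sums of the blocks -/

/-- `A = ∑_{k ≥ -1} A(k)`. -/
def Blocks.Asum (D : Blocks M₀ M₁) : Matrix (Fin M₁) (Fin M₁) ℝ :=
  fun i j => D.Am1 i j + ∑' n, D.A n i j

/-- The mean increment vector `∑_{k ≥ -1} k A(k) e`. -/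
def Blocks.mA (D : Blocks M₀ M₁) : Fin M₁ → ℝ :=
  fun i => -(D.Am1 *ᵥ 1) i + ∑' n : ℕ, (n : ℝ) * (D.A n *ᵥ 1) i

/-- The mean drift `σ = ϖ · ∑_{k ≥ -1} k A(k) e`. -/
def Blocks.drift (D : Blocks M₀ M₁) (ϖ : Fin M₁ → ℝ) : ℝ := ϖ ⬝ᵥ D.mA

/-- The tail sum `∑_{l ≥ k + 1} X(l)` of a sequence of matrices. -/
def tailSum {m n : ℕ} (X : ℕ → Matrix (Fin m) (Fin n) ℝ) (k : ℕ) : Matrix (Fin m) (Fin n) ℝ :=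
  fun i j => ∑' l : ℕ, X (k + 1 + l) i j

/-- The double tail sum `∑_{l ≥ k + 1} ∑_{r ≥ l + 1} X(r)`. -/
def doubleTailSum {m n : ℕ} (X : ℕ → Matrix (Fin m) (Fin n) ℝ) (k : ℕ) :
    Matrix (Fin m) (Fin n) ℝ :=
  tailSum (tailSum X) k

/-- Irreducibility, finite mean upward increments and negative drift. Here `ϖ` is the stationary
distribution of `A = ∑_{k ≥ -1} A(k)`. -/
structure Blocks.Stable (D : Blocks M₀ M₁) (ϖ : Fin M₁ → ℝ) : Prop where
  stochastic : IsStochastic D.P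
  irreducible : D.P.IsIrreducible
  stochastic_A : IsStochastic D.Asum
  irreducible_A : D.Asum.IsIrreducible
  summable_B : ∀ i, Summable fun n : ℕ => ((n + 1 : ℕ) : ℝ) * (D.B (n + 1) *ᵥ 1) i
  /-- finiteness of the mean increment vector, without which the drift is not a real number -/
  summable_A : ∀ i, Summable fun n : ℕ => (n : ℝ) * (D.A n *ᵥ 1) i
  stationary_A : IsStationary D.Asum ϖ
  drift_neg : D.drift ϖ < 0

/-! ### The level-increment truncation -/

/-- The sequence with `X(n)` for `n < N`, with `∑_{l ≥ N} X(l)` at `n = N`, and `0` for `n > N`. -/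
def truncSeq {m n : ℕ} (X : ℕ → Matrix (Fin m) (Fin n) ℝ) (N : ℕ) :
    ℕ → Matrix (Fin m) (Fin n) ℝ :=
  fun k => if k < N then X k else if k = N then (fun i j => ∑' l : ℕ, X (N + l) i j) else 0

/-- The blocks of the level-increment truncation with parameter `N ≥ 1`. -/
def Blocks.trunc (D : Blocks M₀ M₁) (N : ℕ) : Blocks M₀ M₁ where
  Am1 := D.Am1
  A := truncSeq D.A N
  Bm1 := D.Bm1
  B0 := D.B0
  B := truncSeq D.B N

/-! ### Long-tailed distributions -/

/-- `F` is a (cumulative) probability distribution function on `{0, 1, 2, …}`. -/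
structure IsDistributionFunction (F : ℕ → ℝ) : Prop where
  nonneg : ∀ k, 0 ≤ F k
  mono : Monotone F
  tendsto_one : Tendsto F atTop (𝓝 1)

/-- A distribution function `F` is long-tailed: `1 - F` is positive and insensitive to shifts. -/
structure IsLongTailed (F : ℕ → ℝ) : Prop where
  isDistributionFunction : IsDistributionFunction F
  tail_pos : ∀ k, 0 < 1 - F k
  tendsto_ratio : ∀ n : ℕ, Tendsto (fun k => (1 - F (k + n)) / (1 - F k)) atTop (𝓝 1)

/-- The double tail sums of the blocks, applied to `e`, are asymptotic to `c_A (1 - F)` and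
`c_B (1 - F)` for a long-tailed `F`, and `c_A`, `c_B` do not both vanish. -/
structure Blocks.HasLongTail (D : Blocks M₀ M₁) (F : ℕ → ℝ) (cA : Fin M₁ → ℝ) (cB : Fin M₀ → ℝ) :
    Prop where
  longTailed : IsLongTailed F
  tendsto_A : ∀ i, Tendsto (fun N => (doubleTailSum D.A N *ᵥ 1) i / (1 - F N)) atTop (𝓝 (cA i))
  tendsto_B : ∀ i, Tendsto (fun N => (doubleTailSum D.B N *ᵥ 1) i / (1 - F N)) atTop (𝓝 (cB i))
  nonneg_cA : ∀ i, 0 ≤ cA i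
  nonneg_cB : ∀ i, 0 ≤ cB i
  ne_zero : cA ≠ 0 ∨ cB ≠ 0

/-! ### Level-wise subvectors -/

/-- The subvector `p(k)` of `p` belonging to level `k`. -/
def level (p : State M₀ M₁ → ℝ) (k : ℕ) : Phase M₀ M₁ k → ℝ := fun i => p ⟨k, i⟩

/-- The vector `∑_{l ≥ 1} p(l)`. -/
def upperLevels (p : State M₀ M₁ → ℝ) : Fin M₁ → ℝ := fun i => ∑' l : ℕ, level p (l + 1) i

/-- The total variation norm `|x| e` of a finite vector. -/
def tvNorm {ι : Type*} [Fintype ι] (x : ι → ℝ) : ℝ := ∑ i, |x i|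

/-- The constant `(p(0) c_B + (∑_{l ≥ 1} p(l)) c_A) / (-σ)`. -/
def limitConst (σ : ℝ) (p : State M₀ M₁ → ℝ) (cA : Fin M₁ → ℝ) (cB : Fin M₀ → ℝ) : ℝ :=
  ((level p 0 : Fin M₀ → ℝ) ⬝ᵥ cB + upperLevels p ⬝ᵥ cA) / (-σ)

end MG1

end

/-!
The stationary distributions are compared without the deviation matrix of the chain, by testing
them against two kinds of functions.

* *Bounded functions.* For an irreducible stochastic matrix `P` and states `z`, `α`, Poisson's
  equation `b - P b = 1_z - ρ 1_α` has a bounded solution `b` for some constant `ρ`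
  (`exists_bounded_poisson`); it is a combination of two Green functions of the chain killed at
  `α`, which are bounded because `α` can be reached from `z` and from `α`. Testing a stationary
  `p` of `P` gives `p z = ρ p α`, hence uniqueness. Testing a stationary `q` of the truncation
  gives `q z = ρ q α` up to a multiple of the probability of a truncated jump
  (`Blocks.Stable.exists_abs_sub_mul_le`). Since that probability is a difference of two
  consecutive double tails, and `F` is long-tailed, it is `o(1 - F N)`: to this order `q` is
  proportional to `p`.

* *A linear function.* Let `v` solve Poisson's equation of the phase process `A` with right-hand
  side `m_A - σ`, and put `h (k, i) = k + v i` for `k ≥ 1` and `h = 0` in level `0`. Its mean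
  increment is exactly `σ` at every level `≥ 2` (`Blocks.Stable.meanIncrement_eq`), so `h` is a
  Foster–Lyapunov function, for all truncations at once, which yields the existence of stationary
  distributions (`exists_isStationary_of_drift`). The rows of the truncated matrix are the images
  of those of `P` under the map that lowers too high levels and keeps the phase
  (`hasSum_trunc_mul`), so truncation lowers the mean increment of `h` by the mean truncated
  excess, which is the double tail sum. In stationarity the mean increment vanishes even where `h`
  is not integrable (`IsStationary.hasSum_mul_increment`). This identity fixes the factor of
  proportionality between `q` and `p`, up to `o(1 - F N)`
  (`Blocks.Stable.exists_abs_sub_mul_sub_excess_le`).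

The second identity contains the stationary mean of the truncated excess under `q`. As `q` tends
to `p` pointwise, hence in total variation, that mean divided by `1 - F N` tends to `p(0) c_B +
(∑_{l ≥ 1} p(l)) c_A`.
-/

open Filter Topology Matrix

noncomputable section

namespace MG1

/-! ### One-step expectations and increments in stationarity -/

section Chain

variable {S : Type*} {Q : Matrix S S ℝ} {p : S → ℝ}

/-- The one-step expectation `(Q f)(x) = ∑_y Q(x, y) f(y)` as an infinite sum (zero when the sum
does not converge). -/
def expect (Q : Matrix S S ℝ) (f : S → ℝ) (x : S) : ℝ := ∑' y, Q x y * f y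

theorem summable_mul_of_abs_le {a f : S → ℝ} {K : ℝ} (ha : ∀ y, 0 ≤ a y) (hs : Summable a)
    (hf : ∀ y, |f y| ≤ K) : Summable fun y => a y * f y := by
  refine Summable.of_norm_bounded (hs.mul_right K) fun y => ?_
  rw [Real.norm_eq_abs, abs_mul, abs_of_nonneg (ha y)]
  exact mul_le_mul_of_nonneg_left (hf y) (ha y)

theorem abs_tsum_mul_le {a f : S → ℝ} {K : ℝ} (ha : ∀ y, 0 ≤ a y) (hs : Summable a)
    (hf : ∀ y, |f y| ≤ K) : |∑' y, a y * f y| ≤ (∑' y, a y) * K := by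
  have h := tsum_of_norm_bounded (f := fun y => a y * f y) (hs.mul_right K).hasSum fun y => by
    rw [Real.norm_eq_abs, abs_mul, abs_of_nonneg (ha y)]
    exact mul_le_mul_of_nonneg_left (hf y) (ha y)
  rwa [Real.norm_eq_abs, tsum_mul_right] at h

theorem IsStochastic.summable (hQ : IsStochastic Q) (x : S) : Summable fun y => Q x y :=
  (hQ.2 x).summable

theorem IsStochastic.le_one (hQ : IsStochastic Q) (x y : S) : Q x y ≤ 1 :=
  le_hasSum (hQ.2 x) y fun z _ => hQ.1 x z

theorem summable_prod_mul (hQ : IsStochastic Q) (hp : ∀ x, 0 ≤ p x) (hs : Summable p) :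
    Summable fun z : S × S => p z.1 * Q z.1 z.2 := by
  have h0 : 0 ≤ fun z : S × S => p z.1 * Q z.1 z.2 := fun z => mul_nonneg (hp z.1) (hQ.1 z.1 z.2)
  refine (summable_prod_of_nonneg h0).2 ⟨fun x => (hQ.summable x).mul_left (p x), ?_⟩
  refine hs.congr fun x => ?_
  change p x = ∑' y, p x * Q x y
  rw [tsum_mul_left, (hQ.2 x).tsum_eq, mul_one]

theorem IsStationary.summable (hp : IsStationary Q p) : Summable p := hp.hasSum_one.summable

theorem IsStationary.hasSum_mul_expect (hQ : IsStochastic Q) (hp : IsStationary Q p) {f : S → ℝ}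
    {K : ℝ} (hf : ∀ y, |f y| ≤ K) :
    HasSum (fun x => p x * expect Q f x) (∑' y, p y * f y) := by
  have h1 : Summable fun z : S × S => p z.1 * Q z.1 z.2 * f z.2 :=
    summable_mul_of_abs_le (fun z => mul_nonneg (hp.nonneg _) (hQ.1 _ _))
      (summable_prod_mul hQ hp.nonneg hp.summable) fun z => hf z.2
  have h2 := h1.hasSum.prod_fiberwise (g := fun x => p x * expect Q f x) fun x => by
    have := ((summable_mul_of_abs_le (hQ.1 x) (hQ.summable x) hf).hasSum.mul_left (p x))
    simpa only [mul_assoc, expect] using this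
  have h3 : HasSum (fun z : S × S => p z.2 * Q z.2 z.1 * f z.1)
      (∑' z : S × S, p z.1 * Q z.1 z.2 * f z.2) := (Equiv.prodComm S S).hasSum_iff.2 h1.hasSum
  have h4 := h3.prod_fiberwise (g := fun y => p y * f y) fun y => (hp.invariant y).mul_right (f y)
  rwa [h4.tsum_eq]

theorem abs_clamp_sub_clamp_le (n s t : ℝ) :
    |max (-n) (min n s) - max (-n) (min n t)| ≤ |s - t| := by
  have h1 := abs_max_sub_max_le_abs (min n s) (min n t) (-n)
  have h2 := abs_min_sub_min_le_max n s n t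
  rw [max_comm (-n), max_comm (-n)]
  exact h1.trans (h2.trans (by simp))

/-- The increments of `g` over one step have mean zero in stationarity, as soon as their absolute
first moments are uniformly bounded; `g` itself need not be integrable. -/
theorem IsStationary.hasSum_mul_increment (hQ : IsStochastic Q) (hp : IsStationary Q p)
    {g : S → ℝ} {C : ℝ} (hs : ∀ x, Summable fun y => Q x y * |g y - g x|)
    (hC : ∀ x, ∑' y, Q x y * |g y - g x| ≤ C) :
    HasSum (fun x => p x * ∑' y, Q x y * (g y - g x)) 0 := by
  -- clamping `g` to `[-n, n]` shortens its increments and makes it integrable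
  set c : ℕ → ℝ → ℝ := fun n s => max (-(n : ℝ)) (min n s) with hc
  have hcb : ∀ n s, |c n s| ≤ n := fun n s => by
    rw [abs_le]
    exact ⟨le_max_left _ _, max_le (by have : (0 : ℝ) ≤ n := n.cast_nonneg
                                       linarith) (min_le_left _ _)⟩
  have hcl : ∀ s, ∀ᶠ n : ℕ in atTop, c n s = s := fun s => by
    filter_upwards [eventually_ge_atTop ⌈|s|⌉₊] with n hn
    have : |s| ≤ n := (Nat.le_ceil _).trans (by exact_mod_cast hn)
    obtain ⟨h1, h2⟩ := abs_le.1 this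
    simp only [hc, min_eq_right h2, max_eq_right h1]
  have hbd : ∀ n x y, ‖Q x y * (c n (g y) - c n (g x))‖ ≤ Q x y * |g y - g x| := fun n x y => by
    rw [Real.norm_eq_abs, abs_mul, abs_of_nonneg (hQ.1 x y)]
    exact mul_le_mul_of_nonneg_left (abs_clamp_sub_clamp_le _ _ _) (hQ.1 x y)
  have habs : ∀ {a : S → ℝ} {x : S}, (∀ y, ‖Q x y * a y‖ ≤ Q x y * |g y - g x|) →
      ∀ {r : ℝ}, 0 ≤ r → ‖r * ∑' y, Q x y * a y‖ ≤ r * C := fun {a x} h r hr => by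
    rw [norm_mul, Real.norm_eq_abs, abs_of_nonneg hr]
    exact mul_le_mul_of_nonneg_left ((tsum_of_norm_bounded (hs x).hasSum h).trans (hC x)) hr
  have hlim : Tendsto (fun n => ∑' x, p x * ∑' y, Q x y * (c n (g y) - c n (g x))) atTop
      (𝓝 (∑' x, p x * ∑' y, Q x y * (g y - g x))) := by
    refine tendsto_tsum_of_dominated_convergence (bound := fun x => p x * C)
      (hp.summable.mul_right C) (fun x => ?_) (.of_forall fun n x => habs (hbd n x) (hp.nonneg x))
    refine Tendsto.const_mul _ ?_
    refine tendsto_tsum_of_dominated_convergence (bound := fun y => Q x y * |g y - g x|) (hs x)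
      (fun y => ?_) (.of_forall fun n y => hbd n x y)
    refine tendsto_const_nhds.congr' ?_
    filter_upwards [hcl (g y), hcl (g x)] with n h1 h2
    rw [h1, h2]
  -- for the bounded functions `c n ∘ g` the identity is invariance
  have hzero : ∀ n, ∑' x, p x * ∑' y, Q x y * (c n (g y) - c n (g x)) = 0 := fun n => by
    have h1 := hp.hasSum_mul_expect hQ (f := fun y => c n (g y)) fun y => hcb n (g y)
    have h2 := (summable_mul_of_abs_le hp.nonneg hp.summable
      (f := fun y => c n (g y)) fun y => hcb n (g y)).hasSum
    rw [← sub_self (∑' y, p y * c n (g y)), ← (h1.sub h2).tsum_eq]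
    refine tsum_congr fun x => ?_
    rw [← mul_sub]
    congr 1
    have h3 := (summable_mul_of_abs_le (hQ.1 x) (hQ.summable x)
      (f := fun y => c n (g y)) fun y => hcb n (g y)).hasSum.sub
        ((hQ.2 x).mul_right (c n (g x)))
    simp only [← mul_sub, one_mul] at h3
    exact h3.tsum_eq
  have hsum : Summable fun x => p x * ∑' y, Q x y * (g y - g x) :=
    .of_norm_bounded (hp.summable.mul_right C) fun x => habs (fun y => by
      rw [Real.norm_eq_abs, abs_mul, abs_of_nonneg (hQ.1 x y)]) (hp.nonneg x)
  simp only [hzero] at hlim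
  rw [tendsto_nhds_unique tendsto_const_nhds hlim]
  exact hsum.hasSum

/-! ### Bounded solutions of Poisson's equation -/

variable [DecidableEq S]

/-- The matrix `Q` with the column of the state `α` replaced by zero: the transition matrix of the
chain killed on entering `α`. -/
def taboo (Q : Matrix S S ℝ) (α : S) : Matrix S S ℝ := fun x y => if y = α then 0 else Q x y

theorem taboo_nonneg (hQ : IsStochastic Q) (α x y : S) : 0 ≤ taboo Q α x y := by
  unfold taboo
  split_ifs
  exacts [le_rfl, hQ.1 x y]

theorem taboo_le (hQ : IsStochastic Q) (α x y : S) : taboo Q α x y ≤ Q x y := by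
  unfold taboo
  split_ifs
  exacts [hQ.1 x y, le_rfl]

theorem summable_taboo (hQ : IsStochastic Q) (α x : S) : Summable (taboo Q α x) :=
  .of_nonneg_of_le (taboo_nonneg hQ α x) (taboo_le hQ α x) (hQ.summable x)

theorem expect_taboo_add (hQ : IsStochastic Q) {f : S → ℝ} {K : ℝ} (hf : ∀ y, |f y| ≤ K)
    (α x : S) : expect (taboo Q α) f x + Q x α * f α = expect Q f x := by
  have h1 := (summable_mul_of_abs_le (taboo_nonneg hQ α x) (summable_taboo hQ α x) hf).hasSum
  have h2 := hasSum_ite_eq α (Q x α * f α)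
  rw [expect, expect, ← (h1.add h2).tsum_eq]
  refine tsum_congr fun y => ?_
  unfold taboo
  split_ifs with h
  · subst h
    ring
  · ring

theorem expect_taboo_mono (hQ : IsStochastic Q) {f g : S → ℝ} {K L : ℝ} (hf : ∀ y, |f y| ≤ K)
    (hg : ∀ y, |g y| ≤ L) (hfg : ∀ y, f y ≤ g y) (α x : S) :
    expect (taboo Q α) f x ≤ expect (taboo Q α) g x :=
  (summable_mul_of_abs_le (taboo_nonneg hQ α x) (summable_taboo hQ α x) hf).tsum_le_tsum
    (fun y => mul_le_mul_of_nonneg_left (hfg y) (taboo_nonneg hQ α x y))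
    (summable_mul_of_abs_le (taboo_nonneg hQ α x) (summable_taboo hQ α x) hg)

theorem expect_taboo_nonneg (hQ : IsStochastic Q) {f : S → ℝ} (hf : ∀ y, 0 ≤ f y) (α x : S) :
    0 ≤ expect (taboo Q α) f x :=
  tsum_nonneg fun y => mul_nonneg (taboo_nonneg hQ α x y) (hf y)

/-- The one-step transition relation of a nonnegative matrix. -/
def Step (Q : Matrix S S ℝ) (x y : S) : Prop := 0 < Q x y

/-- A bounded supersolution of the equation satisfied by the expected number of visits to `z` before
the first entrance to `α`. It is propagated backwards along a path of positive probability from `z`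
to `α`. -/
theorem exists_bounded_supersolution (hQ : IsStochastic Q) {z α : S}
    (h : Relation.TransGen (Step Q) z α) :
    ∃ (w : S → ℝ) (K : ℝ), (∀ x, 0 ≤ w x) ∧ (∀ x, w x ≤ K) ∧
      ∀ x, (if x = z then 1 else 0) + expect (taboo Q α) w x ≤ w x := by
  have base : ∀ z, Step Q z α → ∃ (w : S → ℝ) (K : ℝ), (∀ x, 0 ≤ w x) ∧ (∀ x, w x ≤ K) ∧
      ∀ x, (if x = z then 1 else 0) + expect (taboo Q α) w x ≤ w x := fun z hz => by
    have hz' : 0 < Q z α := hz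
    have hc : 0 < 1 / Q z α := by positivity
    refine ⟨fun _ => 1 / Q z α, 1 / Q z α, fun _ => hc.le, fun _ => le_rfl, fun x => ?_⟩
    have h1 := expect_taboo_add hQ (f := fun _ => 1 / Q z α) (fun _ => (abs_of_pos hc).le) α x
    have h2 : expect Q (fun _ => 1 / Q z α) x = 1 / Q z α := by
      rw [expect, tsum_mul_right, (hQ.2 x).tsum_eq, one_mul]
    rw [h2] at h1
    split_ifs with hx
    · subst hx
      have : Q x α * (1 / Q x α) = 1 := by field_simp
      linarith
    · have : 0 ≤ Q x α * (1 / Q z α) := mul_nonneg (hQ.1 x α) hc.le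
      linarith
  induction h using Relation.TransGen.head_induction_on with
  | single h => exact base _ h
  | @head z y hzy _ ih =>
    by_cases hyα : y = α
    · exact base z (hyα ▸ hzy)
    obtain ⟨w, K, hw0, hwK, hw⟩ := ih
    have hq : 0 < Q z y := hzy
    have hwabs : ∀ x, |w x| ≤ K := fun x => by rw [abs_of_nonneg (hw0 x)]; exact hwK x
    -- if `w - T w ≥ 1_y`, then `T w - T (T w) ≥ T 1_y ≥ Q(z, y) 1_z`
    set T := expect (taboo Q α) with hT
    have hTw0 : ∀ x, 0 ≤ T w x := expect_taboo_nonneg hQ hw0 α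
    have hTwK : ∀ x, T w x ≤ K := fun x => by
      have := hw x
      have h1 := hwK x
      have : (0 : ℝ) ≤ if x = y then 1 else 0 := by split_ifs <;> norm_num
      linarith
    have hTwabs : ∀ x, |T w x| ≤ K := fun x => by rw [abs_of_nonneg (hTw0 x)]; exact hTwK x
    refine ⟨fun x => T w x / Q z y, K / Q z y, fun x => div_nonneg (hTw0 x) hq.le,
      fun x => div_le_div_of_nonneg_right (hTwK x) hq.le, fun x => ?_⟩
    have h1 : T (fun x => T w x / Q z y) x = T (T w) x / Q z y := by
      simp only [hT, expect, ← mul_div_assoc, tsum_div_const]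
    have h2 : taboo Q α x y + T (T w) x ≤ T w x := by
      have ha := (hasSum_ite_eq y (taboo Q α x y)).add (summable_mul_of_abs_le
        (taboo_nonneg hQ α x) (summable_taboo hQ α x) hTwabs).hasSum
      have hb := (summable_mul_of_abs_le
        (taboo_nonneg hQ α x) (summable_taboo hQ α x) hwabs).hasSum
      refine hasSum_le (fun v => ?_) ha hb
      have := mul_le_mul_of_nonneg_left (hw v) (taboo_nonneg hQ α x v)
      refine le_trans (le_of_eq ?_) this
      rw [mul_add]
      split_ifs with hv <;> simp [hv, hT]
    rw [h1]
    have h3 : (if x = z then 1 else 0 : ℝ) ≤ taboo Q α x y / Q z y := by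
      split_ifs with hx
      · subst hx
        rw [taboo, if_neg hyα, div_self hq.ne']
      · exact div_nonneg (taboo_nonneg hQ α x y) hq.le
    calc _ ≤ taboo Q α x y / Q z y + T (T w) x / Q z y := by gcongr
      _ = (taboo Q α x y + T (T w) x) / Q z y := by ring
      _ ≤ _ := div_le_div_of_nonneg_right h2 hq.le

/-- The expected number of visits to `z` before the first entrance to `α`, as a function of the
initial state, obtained as a monotone limit below a supersolution. -/
theorem exists_bounded_green (hQ : IsStochastic Q) {z α : S}
    (h : Relation.TransGen (Step Q) z α) :
    ∃ (u : S → ℝ) (K : ℝ), (∀ x, 0 ≤ u x) ∧ (∀ x, u x ≤ K) ∧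
      ∀ x, u x = (if x = z then 1 else 0) + expect (taboo Q α) u x := by
  obtain ⟨w, K, hw0, hwK, hw⟩ := exists_bounded_supersolution hQ h
  set T := expect (taboo Q α)
  let U : ℕ → S → ℝ := fun n =>
    n.rec (fun _ => 0) fun _ f x => (if x = z then 1 else 0) + T f x
  have hU : ∀ n x, U (n + 1) x = (if x = z then 1 else 0) + T (U n) x := fun n x => rfl
  have hind : ∀ x, (0 : ℝ) ≤ if x = z then 1 else 0 := fun x => by split_ifs <;> norm_num
  have hwabs : ∀ x, |w x| ≤ K := fun x => by rw [abs_of_nonneg (hw0 x)]; exact hwK x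
  have hU0 : ∀ n x, 0 ≤ U n x := fun n => by
    induction n with
    | zero => exact fun x => le_rfl
    | succ n ih => exact fun x => add_nonneg (hind x) (expect_taboo_nonneg hQ ih α x)
  have hUw : ∀ n x, U n x ≤ w x := fun n => by
    induction n with
    | zero => exact hw0
    | succ n ih =>
      have hb : ∀ y, |U n y| ≤ K := fun y => by
        rw [abs_of_nonneg (hU0 n y)]
        exact (ih y).trans (hwK y)
      exact fun x => (add_le_add_right (expect_taboo_mono hQ hb hwabs ih α x) _).trans (hw x)
  have hUabs : ∀ n x, |U n x| ≤ K := fun n x => by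
    rw [abs_of_nonneg (hU0 n x)]
    exact (hUw n x).trans (hwK x)
  have hmono : ∀ n x, U n x ≤ U (n + 1) x := fun n => by
    induction n with
    | zero => exact hU0 1
    | succ n ih =>
      exact fun x =>
        add_le_add_right (expect_taboo_mono hQ (hUabs n) (hUabs (n + 1)) ih α x) _
  have hlim : ∀ x, Tendsto (fun n => U n x) atTop (𝓝 (⨆ n, U n x)) := fun x =>
    tendsto_atTop_ciSup (monotone_nat_of_le_succ fun n => hmono n x)
      ⟨w x, by rintro _ ⟨n, rfl⟩; exact hUw n x⟩
  refine ⟨fun x => ⨆ n, U n x, K, fun x => ge_of_tendsto' (hlim x) fun n => hU0 n x,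
    fun x => le_of_tendsto' (hlim x) fun n => (hUw n x).trans (hwK x), fun x => ?_⟩
  refine tendsto_nhds_unique ((tendsto_add_atTop_iff_nat 1).2 (hlim x)) ?_
  simp only [hU]
  refine Tendsto.const_add _ ?_
  refine tendsto_tsum_of_dominated_convergence (bound := fun y => taboo Q α x y * K)
    ((summable_taboo hQ α x).mul_right K) (fun y => (hlim y).const_mul _)
    (.of_forall fun n y => ?_)
  rw [Real.norm_eq_abs, abs_mul, abs_of_nonneg (taboo_nonneg hQ α x y)]
  exact mul_le_mul_of_nonneg_left (hUabs n y) (taboo_nonneg hQ α x y)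

/-- Poisson's equation `b - Q b = 1_z - ρ 1_α` has a bounded solution for a suitable constant `ρ`,
without any recurrence assumption. -/
theorem exists_bounded_poisson (hQ : IsStochastic Q) {z α : S}
    (hz : Relation.TransGen (Step Q) z α) (hα : Relation.TransGen (Step Q) α α) :
    ∃ (b : S → ℝ) (K ρ : ℝ), (∀ x, |b x| ≤ K) ∧
      ∀ x, b x - expect Q b x = (if x = z then 1 else 0) - ρ * (if x = α then 1 else 0) := by
  obtain ⟨u, K, hu0, huK, hu⟩ := exists_bounded_green hQ hz
  obtain ⟨v, L, hv0, hvL, hv⟩ := exists_bounded_green hQ hα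
  have huabs : ∀ x, |u x| ≤ K := fun x => by rw [abs_of_nonneg (hu0 x)]; exact huK x
  have hvabs : ∀ x, |v x| ≤ L := fun x => by rw [abs_of_nonneg (hv0 x)]; exact hvL x
  have hvα : v α ≠ 0 := by
    have h1 := hv α
    have h2 := expect_taboo_nonneg hQ hv0 α α
    rw [if_pos rfl] at h1
    linarith
  refine ⟨fun x => u x - u α / v α * v x, K + |u α / v α| * L, u α / v α, fun x => ?_, fun x => ?_⟩
  · refine (abs_sub _ _).trans (add_le_add (huabs x) ?_)
    rw [abs_mul]
    exact mul_le_mul_of_nonneg_left (hvabs x) (abs_nonneg _)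
  · have h1 : expect Q (fun x => u x - u α / v α * v x) x
        = expect Q u x - u α / v α * expect Q v x := by
      have ha := (summable_mul_of_abs_le (hQ.1 x) (hQ.summable x) huabs).hasSum.sub
        ((summable_mul_of_abs_le (hQ.1 x) (hQ.summable x) hvabs).hasSum.mul_left (u α / v α))
      rw [expect, expect, expect, ← ha.tsum_eq]
      exact tsum_congr fun y => by ring
    rw [h1, ← expect_taboo_add hQ huabs α x, ← expect_taboo_add hQ hvabs α x]
    have h2 : u α / v α * v α = u α := div_mul_cancel₀ _ hvα
    linear_combination hu x - u α / v α * hv x + Q x α * h2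

end Chain

section Stationary

variable {S : Type*} {Q : Matrix S S ℝ} {p : S → ℝ}

/-! ### Uniqueness, positivity and existence of stationary distributions -/

theorem IsStationary.hasSum_mul_sub_expect (hQ : IsStochastic Q) (hp : IsStationary Q p) {f : S → ℝ}
    {K : ℝ} (hf : ∀ y, |f y| ≤ K) : HasSum (fun x => p x * (f x - expect Q f x)) 0 := by
  have h := (summable_mul_of_abs_le hp.nonneg hp.summable hf).hasSum.sub
    (hp.hasSum_mul_expect hQ hf)
  simpa only [sub_self, ← mul_sub] using h

/-- If every state leads to the state `α`, there is at most one stationary distribution. -/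
theorem IsStationary.unique (hQ : IsStochastic Q) {α : S}
    (h : ∀ z, Relation.TransGen (Step Q) z α) {p' : S → ℝ} (hp : IsStationary Q p)
    (hp' : IsStationary Q p') : p = p' := by
  classical
  have key : ∀ z, ∃ ρ : ℝ, ∀ q, IsStationary Q q → q z = ρ * q α := fun z => by
    obtain ⟨b, K, ρ, hb, hbe⟩ := exists_bounded_poisson hQ (h z) (h α)
    refine ⟨ρ, fun q hq => ?_⟩
    have h1 := hq.hasSum_mul_sub_expect hQ hb
    have h2 := (hasSum_ite_eq z (q z)).sub ((hasSum_ite_eq α (q α)).mul_left ρ)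
    have h3 := h1.unique (h2.congr_fun fun x => ?_)
    · linarith
    · rw [hbe]
      split_ifs <;> simp_all <;> ring
  choose ρ hρ using key
  have hsum : ∀ q, IsStationary Q q → (∑' z, ρ z) * q α = 1 := fun q hq => by
    rw [← tsum_mul_right, ← hq.hasSum_one.tsum_eq]
    exact tsum_congr fun z => (hρ z q hq).symm
  have hne : (∑' z, ρ z) ≠ 0 := fun h0 => by
    have := hsum p hp
    rw [h0, zero_mul] at this
    exact zero_ne_one this
  have hα : p α = p' α := mul_left_cancel₀ hne ((hsum p hp).trans (hsum p' hp').symm)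
  funext z
  rw [hρ z p hp, hρ z p' hp', hα]

theorem IsStationary.pos (hQ : IsStochastic Q) (h : ∀ x y, Relation.TransGen (Step Q) x y)
    (hp : IsStationary Q p) (y : S) : 0 < p y := by
  have hex : ∃ x, 0 < p x := by
    by_contra! hcon
    have h0 : p = fun _ => 0 := funext fun x => le_antisymm (hcon x) (hp.nonneg x)
    have h1 := hp.hasSum_one
    rw [h0] at h1
    exact zero_ne_one (hasSum_zero.unique h1)
  obtain ⟨x, hx⟩ := hex
  have hstep : ∀ {a b}, Step Q a b → 0 < p a → 0 < p b := fun {a b} hab ha =>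
    (mul_pos ha hab).trans_le
      (le_hasSum (hp.invariant b) a fun z _ => mul_nonneg (hp.nonneg z) (hQ.1 z b))
  induction h x y with
  | single h => exact hstep h hx
  | tail _ h ih => exact hstep h ih

theorem transGen_step_of_isIrreducible (h : Q.IsIrreducible) (x y : S) :
    Relation.TransGen (Step Q) x y := by
  let : Quiver S := Q.toQuiver
  obtain ⟨π, hπ⟩ := h.connected x y
  induction π with
  | nil => simp at hπ
  | @cons b c π e ih =>
    have hstep : Step Q b c := e.down
    cases π with
    | nil => exact .single hstep
    | cons π' e' => exact .tail (ih (by simp)) hstep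

/-- If `h` strictly decreases in mean outside `C` and has finite sublevel sets, then `C` is reached
from everywhere: otherwise `h` would attain a minimum over the states that do not lead to `C`, where
it cannot decrease in mean. -/
theorem exists_reflTransGen_of_drift (hQ : IsStochastic Q) {h : S → ℝ} {C : Set S}
    (hfin : ∀ c, {x | h x ≤ c}.Finite) (hs : ∀ x, Summable fun y => Q x y * h y)
    (hdrift : ∀ x ∉ C, expect Q h x < h x) (x : S) :
    ∃ y ∈ C, Relation.ReflTransGen (Step Q) x y := by
  by_contra hx
  obtain ⟨m, ⟨hmR, hmx⟩, hmin⟩ := Set.exists_min_image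
    {z | (¬ ∃ y ∈ C, Relation.ReflTransGen (Step Q) z y) ∧ h z ≤ h x} h
    ((hfin (h x)).subset fun z hz => hz.2) ⟨x, hx, le_rfl⟩
  have hmC : m ∉ C := fun hm => hmR ⟨m, hm, .refl⟩
  refine (hdrift m hmC).not_ge ?_
  have h1 := (hQ.2 m).mul_right (h m)
  rw [one_mul] at h1
  refine hasSum_le (fun y => ?_) h1 (hs m).hasSum
  rcases (hQ.1 m y).eq_or_lt with h0 | hpos
  · simp [← h0]
  · refine mul_le_mul_of_nonneg_left ?_ hpos.le
    have hyR : ¬ ∃ w ∈ C, Relation.ReflTransGen (Step Q) y w := fun ⟨w, hw, hyw⟩ =>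
      hmR ⟨w, hw, .head hpos hyw⟩
    rcases le_or_gt (h y) (h x) with hle | hlt
    · exact hmin y ⟨hyR, hle⟩
    · exact hmx.trans hlt.le

/-- The image `q Q` of a row vector. -/
def push (Q : Matrix S S ℝ) (q : S → ℝ) (y : S) : ℝ := ∑' x, q x * Q x y

theorem push_nonneg (hQ : IsStochastic Q) {q : S → ℝ} (hq : ∀ x, 0 ≤ q x) (y : S) :
    0 ≤ push Q q y :=
  tsum_nonneg fun x => mul_nonneg (hq x) (hQ.1 x y)

theorem summable_push (hQ : IsStochastic Q) {q : S → ℝ} (hq : ∀ x, 0 ≤ q x) (hs : Summable q)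
    (y : S) : Summable fun x => q x * Q x y :=
  .of_nonneg_of_le (fun x => mul_nonneg (hq x) (hQ.1 x y))
    (fun x => mul_le_of_le_one_right (hq x) (hQ.le_one x y)) hs

theorem hasSum_push_mul (hQ : IsStochastic Q) {q f : S → ℝ} (hq : ∀ x, 0 ≤ q x) (hs : Summable q)
    (hf : ∀ x, 0 ≤ f x) (hfs : ∀ x, Summable fun y => Q x y * f y)
    (hqf : Summable fun x => q x * expect Q f x) :
    HasSum (fun y => push Q q y * f y) (∑' x, q x * expect Q f x) := by
  have h0 : 0 ≤ fun z : S × S => q z.1 * (Q z.1 z.2 * f z.2) := fun z =>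
    mul_nonneg (hq z.1) (mul_nonneg (hQ.1 z.1 z.2) (hf z.2))
  have h1 : Summable fun z : S × S => q z.1 * (Q z.1 z.2 * f z.2) := by
    refine (summable_prod_of_nonneg h0).2 ⟨fun x => (hfs x).mul_left (q x), ?_⟩
    refine hqf.congr fun x => ?_
    change q x * expect Q f x = ∑' y, q x * (Q x y * f y)
    rw [tsum_mul_left, expect]
  have h2 := h1.hasSum.prod_fiberwise (g := fun x => q x * expect Q f x) fun x =>
    (hfs x).hasSum.mul_left (q x)
  have h3 : HasSum (fun z : S × S => q z.2 * (Q z.2 z.1 * f z.1))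
      (∑' z : S × S, q z.1 * (Q z.1 z.2 * f z.2)) := (Equiv.prodComm S S).hasSum_iff.2 h1.hasSum
  have h4 := h3.prod_fiberwise (g := fun y => push Q q y * f y) fun y => by
    have := (summable_push hQ hq hs y).hasSum.mul_right (f y)
    simpa only [mul_assoc, push] using this
  rwa [h2.tsum_eq]

/-- **Foster's criterion**, for a chain that need not be irreducible: a nonnegative function that
decreases in mean by at least `ε` outside a finite set, and increases in mean by a bounded amount
on it, yields a stationary distribution. It is found as a limit of Cesàro averages of the laws of
the chain; the drift keeps mass on the finite set, so the limit is not zero. -/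
theorem exists_isStationary_of_drift [Nonempty S] (hQ : IsStochastic Q) {h : S → ℝ}
    (h0 : ∀ x, 0 ≤ h x) {C : Finset S} {K ε : ℝ} (hε : 0 < ε) (hK : 0 < K)
    (hs : ∀ x, Summable fun y => Q x y * h y)
    (hdrift : ∀ x, expect Q h x ≤ h x - ε + Set.indicator (C : Set S) (fun _ => K) x) :
    ∃ p, IsStationary Q p := by
  classical
  obtain ⟨x₀⟩ := ‹Nonempty S›
  let q : ℕ → S → ℝ := fun n => n.rec (Pi.single x₀ 1) fun _ f => push Q f
  have hq1 : ∀ n, q (n + 1) = push Q (q n) := fun n => rfl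
  have hind : HasSum (Pi.single x₀ 1 : S → ℝ) 1 := hasSum_pi_single x₀ 1
  have hqs : ∀ n, (∀ x, 0 ≤ q n x) ∧ HasSum (q n) 1 := fun n => by
    induction n with
    | zero => exact ⟨fun x => by
        change (0 : ℝ) ≤ (Pi.single x₀ 1 : S → ℝ) x
        rw [Pi.single_apply]; split_ifs <;> norm_num, hind⟩
    | succ n ih =>
      have he : ∀ x, expect Q (fun _ => 1) x = 1 := fun x => by
        simp only [expect, mul_one, (hQ.2 x).tsum_eq]
      refine ⟨push_nonneg hQ ih.1, ?_⟩
      have := hasSum_push_mul hQ ih.1 ih.2.summable (f := fun _ => 1) (fun _ => zero_le_one)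
        (fun x => by simpa only [mul_one] using hQ.summable x)
        (by simpa only [he, mul_one] using ih.2.summable)
      simpa only [he, mul_one, ih.2.tsum_eq, hq1] using this
  have hqh : ∀ n, Summable (fun x => q n x * h x) ∧
      n * ε + ∑' x, q n x * h x ≤ h x₀ + K * ∑ t ∈ Finset.range n, ∑ x ∈ C, q t x := fun n => by
    induction n with
    | zero =>
      have : HasSum (fun x => q 0 x * h x) (h x₀) := by
        have := hasSum_ite_eq x₀ (h x₀)
        refine this.congr_fun fun x => ?_
        change (Pi.single x₀ 1 : S → ℝ) x * h x = _
        rw [Pi.single_apply]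
        split_ifs with hx <;> simp [hx]
      refine ⟨this.summable, ?_⟩
      rw [this.tsum_eq]
      simp
    | succ n ih =>
      obtain ⟨ih1, ih2⟩ := ih
      have hC : HasSum (fun x => q n x * Set.indicator (C : Set S) (fun _ => K) x)
          (K * ∑ x ∈ C, q n x) := by
        have : HasSum (fun x => q n x * Set.indicator (C : Set S) (fun _ => K) x)
            (∑ x ∈ C, q n x * Set.indicator (C : Set S) (fun _ => K) x) :=
          hasSum_sum_of_ne_finset_zero fun x hx => by simp [hx]
        convert this using 1
        rw [Finset.mul_sum]
        exact Finset.sum_congr rfl fun x hx => by simp [hx, mul_comm]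
      have hup : HasSum (fun x => q n x * (h x - ε + Set.indicator (C : Set S) (fun _ => K) x))
          (∑' x, q n x * h x - ε + K * ∑ x ∈ C, q n x) := by
        have := (ih1.hasSum.sub ((hqs n).2.mul_right ε)).add hC
        rw [one_mul] at this
        exact this.congr_fun fun x => by ring
      have hle : ∀ x, q n x * expect Q h x ≤
          q n x * (h x - ε + Set.indicator (C : Set S) (fun _ => K) x) := fun x =>
        mul_le_mul_of_nonneg_left (hdrift x) ((hqs n).1 x)
      have hes : Summable fun x => q n x * expect Q h x :=
        .of_nonneg_of_le (fun x => mul_nonneg ((hqs n).1 x)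
          (tsum_nonneg fun y => mul_nonneg (hQ.1 x y) (h0 y))) hle hup.summable
      have hpm := hasSum_push_mul hQ (hqs n).1 (hqs n).2.summable h0 hs hes
      refine ⟨hpm.summable, ?_⟩
      rw [hq1, hpm.tsum_eq, Finset.sum_range_succ]
      have := hasSum_le hle hes.hasSum hup
      push_cast
      linarith
  -- Cesàro averages and their limit along an ultrafilter
  let avg : ℕ → S → ℝ := fun n x => (∑ t ∈ Finset.range n, q t x) / n
  have hqle : ∀ n x, q n x ≤ 1 := fun n x => le_hasSum (hqs n).2 x fun y _ => (hqs n).1 y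
  have havg0 : ∀ n x, 0 ≤ avg n x := fun n x =>
    div_nonneg (Finset.sum_nonneg fun t _ => (hqs t).1 x) n.cast_nonneg
  have havg1 : ∀ n x, avg n x ≤ 1 := fun n x => by
    refine div_le_one_of_le₀ ((Finset.sum_le_sum fun t _ => hqle t x).trans ?_) n.cast_nonneg
    simp
  let 𝒰 : Ultrafilter ℕ := Ultrafilter.of atTop
  have h𝒰 : (𝒰 : Filter ℕ) ≤ atTop := Ultrafilter.of_le atTop
  have hlim : ∀ x, ∃ r : ℝ, Tendsto (fun n => avg n x) 𝒰 (𝓝 r) := fun x => by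
    obtain ⟨r, _, hr⟩ := (isCompact_Icc (a := (0 : ℝ)) (b := 1)).ultrafilter_le_nhds'
      (𝒰.map fun n => avg n x) (Filter.mem_map.2 (univ_mem' fun n => ⟨havg0 n x, havg1 n x⟩))
    exact ⟨r, hr⟩
  choose r hr using hlim
  have hr0 : ∀ x, 0 ≤ r x := fun x => ge_of_tendsto' (hr x) fun n => havg0 n x
  have havgs : ∀ n, Summable (avg n) ∧ ∑' x, avg n x ≤ 1 := fun n => by
    have h1 : HasSum (avg n) ((∑ t ∈ Finset.range n, (1 : ℝ)) / n) :=
      (hasSum_sum fun t _ => (hqs t).2).div_const _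
    refine ⟨h1.summable, ?_⟩
    rw [h1.tsum_eq]
    simpa using div_self_le_one (n : ℝ)
  have hrsum : ∀ F : Finset S, ∑ x ∈ F, r x ≤ 1 := fun F =>
    le_of_tendsto' (tendsto_finsetSum F fun x _ => hr x) fun n =>
      ((havgs n).1.sum_le_tsum F fun x _ => havg0 n x).trans (havgs n).2
  have hrs : Summable r := summable_of_sum_le hr0 hrsum
  have hmass : ε / K ≤ ∑ x ∈ C, r x := by
    refine ge_of_tendsto (x := (𝒰 : Filter ℕ))
      (f := fun n : ℕ => ∑ x ∈ C, avg n x + h x₀ / K * (n : ℝ)⁻¹) ?_ ?_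
    · have := (tendsto_inv_atTop_nhds_zero_nat (𝕜 := ℝ)).mono_left h𝒰
      simpa using (tendsto_finsetSum C fun x _ => hr x).add (this.const_mul (h x₀ / K))
    · filter_upwards [h𝒰 (eventually_gt_atTop 0)] with n hn
      have hn' : (0 : ℝ) < n := by exact_mod_cast hn
      have h1 := (hqh n).2
      have h2 : 0 ≤ ∑' x, q n x * h x := tsum_nonneg fun x => mul_nonneg ((hqs n).1 x) (h0 x)
      have h3 : ∑ x ∈ C, avg n x = (∑ t ∈ Finset.range n, ∑ x ∈ C, q t x) / n := by
        rw [Finset.sum_comm, Finset.sum_div]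
      rw [h3, div_le_iff₀ hK]
      have h4 : ((∑ t ∈ Finset.range n, ∑ x ∈ C, q t x) / n + h x₀ / K * (n : ℝ)⁻¹) * K
          = (h x₀ + K * ∑ t ∈ Finset.range n, ∑ x ∈ C, q t x) / n := by
        field_simp
        ring
      rw [h4, le_div_iff₀ hn']
      linarith
  -- Fatou's lemma gives `r Q ≤ r`; the total masses agree, so equality holds
  have hpushle : ∀ y, push Q r y ≤ r y := fun y => by
    refine Real.tsum_le_of_sum_le (fun x => mul_nonneg (hr0 x) (hQ.1 x y)) fun F => ?_
    have hl : Tendsto (fun n => ∑ x ∈ F, avg n x * Q x y) 𝒰 (𝓝 (∑ x ∈ F, r x * Q x y)) :=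
      tendsto_finsetSum F fun x _ => (hr x).mul_const _
    have hu : Tendsto (fun n : ℕ => avg n y + (n : ℝ)⁻¹) 𝒰 (𝓝 (r y)) := by
      have := (tendsto_inv_atTop_nhds_zero_nat (𝕜 := ℝ)).mono_left h𝒰
      simpa using (hr y).add this
    refine le_of_tendsto_of_tendsto' hl hu fun n => ?_
    have h1 : HasSum (fun x => avg n x * Q x y) ((∑ t ∈ Finset.range n, q (t + 1) y) / n) := by
      have := (hasSum_sum (s := Finset.range n) fun t _ =>
        (summable_push hQ (hqs t).1 (hqs t).2.summable y).hasSum).div_const (n : ℝ)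
      refine this.congr_fun fun x => ?_
      simp only [avg, Finset.sum_div, Finset.sum_mul]
      exact Finset.sum_congr rfl fun t _ => by ring
    refine (sum_le_hasSum F (fun x _ => mul_nonneg (havg0 n x) (hQ.1 x y)) h1).trans ?_
    have h2 : ∑ t ∈ Finset.range n, q (t + 1) y ≤ ∑ t ∈ Finset.range n, q t y + 1 := by
      have := Finset.sum_range_succ (fun t => q t y) n
      rw [Finset.sum_range_succ'] at this
      linarith [hqle n y, (hqs 0).1 y]
    calc _ ≤ (∑ t ∈ Finset.range n, q t y + 1) / n := by gcongr
      _ = _ := by simp only [avg]; ring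
  have hpushsum : HasSum (push Q r) (∑' x, r x) := by
    have he : ∀ x, expect Q (fun _ => 1) x = 1 := fun x => by
      simp only [expect, mul_one, (hQ.2 x).tsum_eq]
    have := hasSum_push_mul hQ hr0 hrs (f := fun _ => 1) (fun _ => zero_le_one)
      (fun x => by simpa only [mul_one] using hQ.summable x)
      (by simpa only [he, mul_one] using hrs)
    simpa only [he, mul_one] using this
  have hpusheq : ∀ y, push Q r y = r y := fun y => by
    have h1 := (hasSum_zero_iff_of_nonneg fun y => sub_nonneg.2 (hpushle y)).1
      (by simpa using hrs.hasSum.sub hpushsum)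
    have := congrFun h1 y
    simp only [Pi.zero_apply] at this
    linarith
  have hpos : 0 < ∑' x, r x := (div_pos hε hK).trans_le
    (hmass.trans (hrs.sum_le_tsum C fun x _ => hr0 x))
  refine ⟨fun x => r x / ∑' x, r x, fun x => div_nonneg (hr0 x) hpos.le, ?_, fun y => ?_⟩
  · have := hrs.hasSum.div_const (∑' x, r x)
    rwa [div_self hpos.ne'] at this
  · have := (summable_push hQ hr0 hrs y).hasSum.div_const (∑' x, r x)
    rw [← push, hpusheq] at this
    exact this.congr_fun fun x => by ring

/-- Poisson's equation of a finite irreducible chain. -/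
theorem exists_finite_poisson {ι : Type*} [Fintype ι] [Nonempty ι] {A : Matrix ι ι ℝ}
    (hA : IsStochastic A) (hirr : A.IsIrreducible) {ϖ : ι → ℝ} (hϖ : IsStationary A ϖ)
    {f : ι → ℝ} (hf : ϖ ⬝ᵥ f = 0) : ∃ v : ι → ℝ, ∀ i, v i - ∑ j, A i j * v j = f i := by
  classical
  obtain ⟨α⟩ := ‹Nonempty ι›
  have hreach := transGen_step_of_isIrreducible hirr
  have key := fun z => exists_bounded_poisson hA (hreach z α) (hreach α α)
  choose b K ρ hb hbe using key
  have hρ : ∀ z, ϖ z = ρ z * ϖ α := fun z => by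
    have h1 := hϖ.hasSum_mul_sub_expect hA (hb z)
    have h2 := (hasSum_fintype _).unique h1
    simp only [hbe, mul_sub, Finset.sum_sub_distrib] at h2
    simp at h2
    linarith
  have hα := hϖ.pos hA hreach α
  have hsum : ∑ z, f z * ρ z = 0 := by
    have : (∑ z, f z * ρ z) * ϖ α = 0 := by
      rw [← hf, Finset.sum_mul, dotProduct]
      exact Finset.sum_congr rfl fun z _ => by rw [hρ z]; ring
    exact (mul_eq_zero.1 this).resolve_right hα.ne'
  refine ⟨fun i => ∑ z, f z * b z i, fun i => ?_⟩
  have h1 : ∑ j, A i j * ∑ z, f z * b z j = ∑ z, f z * expect A (b z) i := by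
    simp only [expect, tsum_fintype, Finset.mul_sum]
    rw [Finset.sum_comm]
    exact Finset.sum_congr rfl fun z _ => Finset.sum_congr rfl fun j _ => by ring
  rw [h1, ← Finset.sum_sub_distrib]
  simp only [← mul_sub, hbe]
  simp only [mul_sub, Finset.sum_sub_distrib, ← mul_assoc, ← Finset.sum_mul, hsum]
  simp

end Stationary

variable {M₀ M₁ : ℕ}

/-! ### The entries of the transition matrix -/

/-- The state with level `0` and phase `i`. -/
def zeroState (i : Fin M₀) : State M₀ M₁ := ⟨0, i⟩

/-- The state with level `k + 1` and phase `i`. -/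
def succState (k : ℕ) (i : Fin M₁) : State M₀ M₁ := ⟨k + 1, i⟩

@[simp] theorem zeroState_fst (i : Fin M₀) : (zeroState i : State M₀ M₁).1 = 0 := rfl

@[simp] theorem succState_fst (k : ℕ) (i : Fin M₁) :
    (succState k i : State M₀ M₁).1 = k + 1 := rfl

@[elab_as_elim] theorem state_cases {motive : State M₀ M₁ → Prop}
    (zero : ∀ i, motive (zeroState i)) (succ : ∀ k i, motive (succState k i)) (x) : motive x := by
  obtain ⟨k, i⟩ := x
  cases k with
  | zero => exact zero i
  | succ k => exact succ k i

/-- The phase of a state, without its level: phases of level `0` on the left, of the other levels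
on the right. -/
def kind : State M₀ M₁ → Fin M₀ ⊕ Fin M₁
  | ⟨0, i⟩ => .inl i
  | ⟨_ + 1, i⟩ => .inr i

@[simp] theorem kind_zeroState (i : Fin M₀) : kind (zeroState i : State M₀ M₁) = .inl i := rfl

@[simp] theorem kind_succState (k : ℕ) (i : Fin M₁) :
    kind (succState k i : State M₀ M₁) = .inr i := rfl

theorem state_ext {x y : State M₀ M₁} (h1 : x.1 = y.1) (h2 : kind x = kind y) : x = y := by
  obtain ⟨k, i⟩ := x
  obtain ⟨l, j⟩ := y
  obtain rfl : k = l := h1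
  cases k with
  | zero => rw [Sum.inl.inj h2]
  | succ k => rw [Sum.inr.inj h2]

section Entries

variable (D : Blocks M₀ M₁)

theorem Blocks.P_zero_succ (i : Fin M₀) (l : ℕ) (j : Fin M₁) :
    D.P (zeroState i) (succState l j) = D.B (l + 1) i j := rfl

theorem Blocks.P_succ_succ (k : ℕ) (i : Fin M₁) (l : ℕ) (j : Fin M₁) :
    D.P (succState k i) (succState l j)
      = if k ≤ l then D.A (l - k) i j else if l + 1 = k then D.Am1 i j else 0 := by
  cases k <;> rfl

/-- Downward jumps skip no level. -/
theorem Blocks.P_eq_zero {x y : State M₀ M₁} (h : y.1 + 1 < x.1) : D.P x y = 0 := by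
  induction x using state_cases with
  | zero i => simp at h
  | succ k i =>
    induction y using state_cases with
    | zero j =>
      simp only [zeroState_fst, succState_fst] at h
      obtain ⟨k, rfl⟩ : ∃ m, k = m + 1 := ⟨k - 1, by omega⟩
      rfl
    | succ l j =>
      simp only [succState_fst] at h
      rw [D.P_succ_succ, if_neg (by omega), if_neg (by omega)]

/-- The probability of a jump from a state of the given kind to the level `n ≥ 1` steps higher. -/
def Blocks.upMass : Fin M₀ ⊕ Fin M₁ → ℕ → ℝ
  | .inl i, n => (D.B n *ᵥ 1) i
  | .inr i, n => (D.A n *ᵥ 1) i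

theorem Blocks.sum_P_up (x : State M₀ M₁) (n : ℕ) :
    ∑ j, D.P x (succState (x.1 + n) j) = D.upMass (kind x) (n + 1) := by
  induction x using state_cases with
  | zero i =>
    simp [Blocks.upMass, Matrix.mulVec, dotProduct, D.P_zero_succ]
  | succ k i =>
    simp [Blocks.upMass, Matrix.mulVec, dotProduct, D.P_succ_succ, add_assoc, add_comm 1 n]

end Entries

theorem hasSum_levels {g : State M₀ M₁ → ℝ} {s : ℝ} (h : HasSum g s) :
    HasSum (fun k => ∑ j, g ⟨k, j⟩) s :=
  h.sigma fun _ => hasSum_fintype _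

theorem hasSum_of_levels {g : State M₀ M₁ → ℝ} {s : ℝ} (h0 : ∀ y, 0 ≤ g y)
    (h : HasSum (fun k => ∑ j, g ⟨k, j⟩) s) : HasSum g s := by
  have hs : Summable g := (summable_sigma_of_nonneg h0).2
    ⟨fun _ => (hasSum_fintype _).summable, by simpa only [tsum_fintype] using h.summable⟩
  rw [h.unique (hasSum_levels hs.hasSum)]
  exact hs.hasSum

theorem finite_levels_le (n : ℕ) : {x : State M₀ M₁ | x.1 ≤ n}.Finite := by
  refine ((Finset.range (n + 1)).sigma fun _ => Finset.univ).finite_toSet.subset fun x hx => ?_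
  have : x.1 ≤ n := hx
  simpa using Nat.lt_succ_of_le this

variable {D : Blocks M₀ M₁}

theorem Blocks.upMass_nonneg (hP : IsStochastic D.P) (a : Fin M₀ ⊕ Fin M₁) (n : ℕ) :
    0 ≤ D.upMass a (n + 1) := by
  have : ∀ x : State M₀ M₁, 0 ≤ D.upMass (kind x) (n + 1) := fun x => by
    rw [← D.sum_P_up]
    exact Finset.sum_nonneg fun j _ => hP.1 _ _
  cases a with
  | inl i => exact this ⟨0, i⟩
  | inr i => exact this ⟨1, i⟩

/-- Mean of a nonnegative function of the upward part of the level increment. -/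
theorem hasSum_P_up (hP : IsStochastic D.P) (x : State M₀ M₁) {ψ : ℕ → ℝ} (hψ : ∀ n, 0 ≤ ψ n)
    (hψ0 : ψ 0 = 0) {s : ℝ} (h : HasSum (fun n => D.upMass (kind x) (n + 1) * ψ (n + 1)) s) :
    HasSum (fun y => D.P x y * ψ (y.1 - x.1)) s := by
  refine hasSum_of_levels (fun y => mul_nonneg (hP.1 _ _) (hψ _)) ?_
  have hinj : Function.Injective fun n : ℕ => x.1 + n + 1 := fun a b hab => by simpa using hab
  refine (hinj.hasSum_iff fun k hk => ?_).1 ?_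
  · have hk' : k - x.1 = 0 := by
      by_contra hne
      exact hk ⟨k - x.1 - 1, by simp; omega⟩
    refine Finset.sum_eq_zero fun j _ => ?_
    change _ * ψ (k - x.1) = 0
    rw [hk', hψ0, mul_zero]
  · refine h.congr_fun fun n => ?_
    change ∑ j : Fin M₁, D.P x (succState (x.1 + n) j) * ψ (x.1 + n + 1 - x.1) = _
    rw [← Finset.sum_mul, D.sum_P_up, show x.1 + n + 1 - x.1 = n + 1 by omega]

/-! ### The truncated chain as a projection of the original one -/

/-- Lower the level of a state to `t + 1` if it is larger, keeping the phase. -/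
def cap (t : ℕ) : State M₀ M₁ → State M₀ M₁
  | ⟨0, j⟩ => ⟨0, j⟩
  | ⟨m + 1, j⟩ => ⟨min m t + 1, j⟩

theorem cap_fst (t : ℕ) (z : State M₀ M₁) : (cap t z).1 = min z.1 (t + 1) := by
  obtain ⟨m, j⟩ := z
  cases m with
  | zero => simp [cap]
  | succ m =>
    change min m t + 1 = min (m + 1) (t + 1)
    omega

theorem kind_cap (t : ℕ) (z : State M₀ M₁) : kind (cap t z) = kind z := by
  obtain ⟨m, j⟩ := z
  cases m <;> rfl

theorem cap_eq_self {t : ℕ} {z : State M₀ M₁} (h : z.1 ≤ t + 1) : cap t z = z := by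
  obtain ⟨m, j⟩ := z
  cases m with
  | zero => rfl
  | succ m =>
    have : min m t = m := by simp at h; omega
    change (⟨min m t + 1, j⟩ : State M₀ M₁) = _
    rw [this]

theorem trunc_P_of_lt {N : ℕ} {x y : State M₀ M₁} (h : y.1 < x.1 + (N + 1)) :
    (D.trunc (N + 1)).P x y = D.P x y := by
  induction x using state_cases with
  | zero i =>
    induction y using state_cases with
    | zero j => rfl
    | succ l j =>
      simp only [zeroState_fst, succState_fst] at h
      simp only [Blocks.P_zero_succ, Blocks.trunc, truncSeq]
      rw [if_pos (by omega)]
  | succ k i =>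
    induction y using state_cases with
    | zero j => cases k <;> rfl
    | succ l j =>
      simp only [succState_fst] at h
      simp only [Blocks.P_succ_succ, Blocks.trunc, truncSeq]
      rw [if_pos (show l - k < N + 1 by omega)]

theorem truncSeq_of_gt {m n : ℕ} (X : ℕ → Matrix (Fin m) (Fin n) ℝ) {N k : ℕ} (h : N < k) :
    truncSeq X N k = 0 := by
  exact (if_neg (show ¬ k < N by omega)).trans (if_neg (show ¬ k = N by omega))

theorem trunc_P_of_gt {N : ℕ} {x y : State M₀ M₁} (h : x.1 + (N + 1) < y.1) :
    (D.trunc (N + 1)).P x y = 0 := by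
  induction y using state_cases with
  | zero j => simp at h
  | succ l j =>
    induction x using state_cases with
    | zero i =>
      simp only [zeroState_fst, succState_fst] at h
      simp only [Blocks.P_zero_succ, Blocks.trunc]
      rw [truncSeq_of_gt _ (by omega)]
      rfl
    | succ k i =>
      simp only [succState_fst] at h
      simp only [Blocks.P_succ_succ, Blocks.trunc]
      rw [if_pos (by omega), truncSeq_of_gt _ (by omega)]
      rfl

theorem trunc_P_of_eq (N : ℕ) (x : State M₀ M₁) (j : Fin M₁) :
    (D.trunc (N + 1)).P x (succState (x.1 + N) j)
      = ∑' n : ℕ, D.P x (succState (x.1 + N + n) j) := by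
  induction x using state_cases with
  | zero i =>
    simp only [Blocks.P_zero_succ, Blocks.trunc, truncSeq, zeroState_fst, Nat.zero_add, lt_irrefl,
      if_false]
    exact tsum_congr fun n => by rw [Nat.add_right_comm]
  | succ k i =>
    have h1 : k + 1 + N - k = N + 1 := by omega
    simp only [Blocks.P_succ_succ, Blocks.trunc, truncSeq, succState_fst, h1, lt_irrefl, if_false,
      if_true, show k ≤ k + 1 + N by omega]
    refine tsum_congr fun n => ?_
    rw [if_pos (by omega), show k + 1 + N + n - k = N + 1 + n by omega]

/-- Each row of the truncated transition matrix is the image of the corresponding row of `P` under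
the map that lowers too high levels. -/
theorem hasSum_fiber_cap (hP : IsStochastic D.P) (N : ℕ) (x y : State M₀ M₁) :
    HasSum (fun z : cap (x.1 + N) ⁻¹' {y} => D.P x z) ((D.trunc (N + 1)).P x y) := by
  refine (hasSum_subtype_iff_indicator (f := D.P x)).2 ?_
  rcases lt_trichotomy y.1 (x.1 + (N + 1)) with h | h | h
  · rw [trunc_P_of_lt h]
    have : cap (x.1 + N) ⁻¹' {y} = {y} := by
      ext z
      simp only [Set.mem_preimage, Set.mem_singleton_iff]
      refine ⟨fun hz => ?_, fun hz => by rw [hz]; exact cap_eq_self (by omega)⟩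
      have h1 := cap_fst (x.1 + N) z
      rw [hz] at h1
      rwa [cap_eq_self (by omega)] at hz
    rw [this]
    classical
    refine (hasSum_ite_eq y (D.P x y)).congr_fun fun z => ?_
    simp only [Set.indicator, Set.mem_singleton_iff]
    split_ifs with hz
    · rw [hz]
    · rfl
  · induction y using state_cases with
    | zero j => simp at h
    | succ l j =>
    obtain rfl : l = x.1 + N := by simp only [succState_fst] at h; omega
    rw [trunc_P_of_eq]
    let ι : ℕ → State M₀ M₁ := fun n => succState (x.1 + N + n) j
    have hι : Function.Injective ι := fun a b hab => by
      have : x.1 + N + a + 1 = x.1 + N + b + 1 := congrArg Sigma.fst hab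
      omega
    have hcap : ∀ n, cap (x.1 + N) (ι n) = succState (x.1 + N) j := fun n =>
      state_ext (by rw [cap_fst]; simp [ι]) (by rw [kind_cap]; rfl)
    refine (hι.hasSum_iff fun z hz => ?_).1 ?_
    · refine Set.indicator_of_notMem (fun hz' => hz ?_) _
      have hz1 : cap (x.1 + N) z = succState (x.1 + N) j := hz'
      have h1 := cap_fst (x.1 + N) z
      rw [hz1, succState_fst] at h1
      refine ⟨z.1 - (x.1 + N + 1), state_ext ?_ ?_⟩
      · change x.1 + N + (z.1 - (x.1 + N + 1)) + 1 = z.1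
        omega
      · rw [← kind_cap (x.1 + N) z, hz1]
        rfl
    · have hs : Summable fun n => D.P x (ι n) := (hP.summable x).comp_injective hι
      refine hs.hasSum.congr_fun fun n => ?_
      exact Set.indicator_of_mem (show ι n ∈ cap (x.1 + N) ⁻¹' {_} from hcap n) _
  · rw [trunc_P_of_gt h]
    have : cap (x.1 + N) ⁻¹' {y} = ∅ := by
      ext z
      simp only [Set.mem_preimage, Set.mem_singleton_iff, Set.mem_empty_iff_false, iff_false]
      intro hz
      have h1 := cap_fst (x.1 + N) z
      rw [hz] at h1
      omega
    rw [this, Set.indicator_empty]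
    exact hasSum_zero

theorem hasSum_trunc_mul (hP : IsStochastic D.P) (N : ℕ) (x : State M₀ M₁) {f : State M₀ M₁ → ℝ}
    (hs : Summable fun z => D.P x z * f (cap (x.1 + N) z)) :
    HasSum (fun y => (D.trunc (N + 1)).P x y * f y)
      (∑' z, D.P x z * f (cap (x.1 + N) z)) := by
  refine (hs.hasSum.tsum_fiberwise (cap (x.1 + N))).congr_fun fun y => ?_
  rw [← ((hasSum_fiber_cap hP N x y).mul_right (f y)).tsum_eq]
  exact tsum_congr fun z => by rw [show cap (x.1 + N) z = y from z.2]

theorem isStochastic_trunc (hP : IsStochastic D.P) (N : ℕ) :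
    IsStochastic (D.trunc (N + 1)).P := by
  refine ⟨fun x y => (hasSum_fiber_cap hP N x y).nonneg fun z => hP.1 _ _, fun x => ?_⟩
  have := hasSum_trunc_mul hP N x (f := fun _ => 1) (by simpa using hP.summable x)
  simpa only [mul_one, (hP.2 x).tsum_eq] using this

theorem P_le_trunc_P (hP : IsStochastic D.P) {N : ℕ} {x y : State M₀ M₁} (h : y.1 ≤ N + 1) :
    D.P x y ≤ (D.trunc (N + 1)).P x y :=
  le_hasSum (hasSum_fiber_cap hP N x y) ⟨y, cap_eq_self (by omega)⟩ fun z _ => hP.1 _ _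

variable {ϖ : Fin M₁ → ℝ}

/-! ### Tail sums of the upward increments -/

/-- Double tail sums as weighted single sums. -/
theorem tsum_shift_eq {a : ℕ → ℝ} (ha : ∀ n, 0 ≤ a n)
    (hs : Summable fun n : ℕ => ((n + 1 : ℕ) : ℝ) * a n) :
    ∑' l, ∑' r, a (l + r) = ∑' n : ℕ, ((n + 1 : ℕ) : ℝ) * a n := by
  have h0 : ∀ z : Σ n : ℕ, Finset.HasAntidiagonal.antidiagonal n, 0 ≤ a z.1 := fun z => ha _
  have hf : ∀ n, HasSum (fun _ : Finset.HasAntidiagonal.antidiagonal n => a n)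
      (((n + 1 : ℕ) : ℝ) * a n) := fun n => by
    simpa using hasSum_fintype fun _ : Finset.HasAntidiagonal.antidiagonal n => a n
  have h1 : Summable fun z : Σ n : ℕ, Finset.HasAntidiagonal.antidiagonal n => a z.1 :=
    (summable_sigma_of_nonneg h0).2 ⟨fun n => (hf n).summable, by
      simpa only [(hf _).tsum_eq] using hs⟩
  have h2 : HasSum (fun z : Σ n : ℕ, Finset.HasAntidiagonal.antidiagonal n => a z.1)
      (∑' n : ℕ, ((n + 1 : ℕ) : ℝ) * a n) := by
    rw [(h1.hasSum.sigma hf).tsum_eq]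
    exact h1.hasSum
  have h3 : HasSum (fun z : ℕ × ℕ => a (z.1 + z.2)) (∑' n : ℕ, ((n + 1 : ℕ) : ℝ) * a n) := by
    refine Finset.HasAntidiagonal.sigmaAntidiagonalEquivProd.hasSum_iff.1 (h2.congr_fun fun z => ?_)
    obtain ⟨n, ⟨⟨l, r⟩, hz⟩⟩ := z
    have : l + r = n := Finset.HasAntidiagonal.mem_antidiagonal.1 hz
    simp [Finset.HasAntidiagonal.sigmaAntidiagonalEquivProd, this]
  rw [← h3.tsum_eq, h3.summable.tsum_prod]

/-- The probability that the level increases by more than `N + 1` in one step. -/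
def Blocks.upTail (D : Blocks M₀ M₁) (a : Fin M₀ ⊕ Fin M₁) (N : ℕ) : ℝ :=
  ∑' n : ℕ, D.upMass a (N + 1 + n + 1)

/-- The mean excess over `N + 1` of the upward level increment in one step. -/
def Blocks.upExcess (D : Blocks M₀ M₁) (a : Fin M₀ ⊕ Fin M₁) (N : ℕ) : ℝ :=
  ∑' n : ℕ, ((n + 1 : ℕ) : ℝ) * D.upMass a (N + 1 + n + 1)

namespace Blocks.Stable

theorem summable_upMass (hD : D.Stable ϖ) (a : Fin M₀ ⊕ Fin M₁) :
    Summable fun n : ℕ => ((n + 1 : ℕ) : ℝ) * D.upMass a (n + 1) := by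
  cases a with
  | inl i => exact hD.summable_B i
  | inr i =>
    exact (summable_nat_add_iff (f := fun n : ℕ => (n : ℝ) * (D.A n *ᵥ 1) i) 1).2 (hD.summable_A i)

theorem summable_upMass_shift (hD : D.Stable ϖ) (a : Fin M₀ ⊕ Fin M₁) (N : ℕ) :
    Summable fun n : ℕ => ((n + 1 : ℕ) : ℝ) * D.upMass a (N + n + 1) := by
  have h := (summable_nat_add_iff N).2 (hD.summable_upMass a)
  refine .of_nonneg_of_le (fun n => mul_nonneg (Nat.cast_nonneg _)
    (D.upMass_nonneg hD.stochastic a _)) (fun n => ?_) h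
  rw [Nat.add_comm N n]
  refine mul_le_mul_of_nonneg_right ?_ (D.upMass_nonneg hD.stochastic a _)
  exact_mod_cast (by omega : n + 1 ≤ n + N + 1)

theorem summable_upMass_tail (hD : D.Stable ϖ) (a : Fin M₀ ⊕ Fin M₁) (N : ℕ) :
    Summable fun n : ℕ => D.upMass a (N + n + 1) := by
  refine .of_nonneg_of_le (fun n => D.upMass_nonneg hD.stochastic a _) (fun n => ?_)
    (hD.summable_upMass_shift a N)
  refine le_mul_of_one_le_left (D.upMass_nonneg hD.stochastic a _) ?_
  exact_mod_cast (by omega : 1 ≤ n + 1)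

theorem upTail_nonneg (hD : D.Stable ϖ) (a : Fin M₀ ⊕ Fin M₁) (N : ℕ) : 0 ≤ D.upTail a N :=
  tsum_nonneg fun _ => D.upMass_nonneg hD.stochastic a _

theorem upExcess_nonneg (hD : D.Stable ϖ) (a : Fin M₀ ⊕ Fin M₁) (N : ℕ) : 0 ≤ D.upExcess a N :=
  tsum_nonneg fun _ => mul_nonneg (Nat.cast_nonneg _) (D.upMass_nonneg hD.stochastic a _)

theorem upTail_eq (hD : D.Stable ϖ) (a : Fin M₀ ⊕ Fin M₁) (N : ℕ) :
    D.upTail a N = D.upExcess a N - D.upExcess a (N + 1) := by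
  have h1 := (hD.summable_upMass_shift a (N + 1)).hasSum
  have h2 := (hD.summable_upMass_shift a (N + 1 + 1)).hasSum
  have h3 := (hD.summable_upMass_tail a (N + 1)).hasSum
  have h4 := (hasSum_nat_add_iff' 1).2 h1
  have h5 := (hasSum_nat_add_iff' 1).2 h3
  have h6 := h4.sub h2
  have h7 := h6.unique (h5.congr_fun fun n => ?_)
  · simp only [Finset.sum_range_one] at h7
    simp only [upTail, upExcess]
    push_cast at h7 ⊢
    linarith
  · rw [show N + 1 + (n + 1) + 1 = N + 1 + 1 + n + 1 by omega]
    push_cast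
    ring

theorem hasSum_up_tail (hD : D.Stable ϖ) (x : State M₀ M₁) (N : ℕ) :
    HasSum (fun y => D.P x y * if x.1 + N + 1 < y.1 then 1 else 0) (D.upTail (kind x) N) := by
  let ψ : ℕ → ℝ := fun n => if N + 1 < n then 1 else 0
  have h1 : HasSum (fun n => D.upMass (kind x) (n + 1) * ψ (n + 1)) (D.upTail (kind x) N) := by
    have h3 := (hD.summable_upMass_tail (kind x) (N + 1)).hasSum
    have hinj : Function.Injective fun n : ℕ => N + 1 + n := add_right_injective _
    refine (hinj.hasSum_iff fun k hk => ?_).1 (h3.congr_fun fun n => ?_)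
    · have : ¬ N + 1 < k + 1 := fun h => hk ⟨k - (N + 1), by simp; omega⟩
      simp only [ψ, if_neg this, mul_zero]
    · simp only [ψ, Function.comp_apply, if_pos (show N + 1 < N + 1 + n + 1 by omega), mul_one]
  refine (hasSum_P_up hD.stochastic x (fun n => ?_) (by simp [ψ]) h1).congr_fun fun y => ?_
  · simp only [ψ]
    split_ifs <;> norm_num
  · simp only [ψ]
    congr 1
    exact if_congr (by omega) rfl rfl

theorem hasSum_up_excess (hD : D.Stable ϖ) (x : State M₀ M₁) (N : ℕ) :
    HasSum (fun y => D.P x y * ((y.1 - x.1 - (N + 1) : ℕ) : ℝ)) (D.upExcess (kind x) N) := by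
  let ψ : ℕ → ℝ := fun n => ((n - (N + 1) : ℕ) : ℝ)
  have h1 : HasSum (fun n => D.upMass (kind x) (n + 1) * ψ (n + 1)) (D.upExcess (kind x) N) := by
    have h3 := (hD.summable_upMass_shift (kind x) (N + 1)).hasSum
    have hinj : Function.Injective fun n : ℕ => N + 1 + n := add_right_injective _
    refine (hinj.hasSum_iff fun k hk => ?_).1 (h3.congr_fun fun n => ?_)
    · have : k + 1 - (N + 1) = 0 := by
        by_contra h
        exact hk ⟨k - (N + 1), by simp; omega⟩
      simp only [ψ, this, Nat.cast_zero, mul_zero]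
    · simp only [ψ, Function.comp_apply, show N + 1 + n + 1 - (N + 1) = n + 1 by omega]
      ring
  have hψ0 : ψ 0 = 0 := by simp [ψ]
  have h2 := hasSum_P_up hD.stochastic x (ψ := ψ) (fun _ => Nat.cast_nonneg _) hψ0 h1
  exact h2

theorem hasSum_up (hD : D.Stable ϖ) (x : State M₀ M₁) :
    HasSum (fun y => D.P x y * ((y.1 - x.1 : ℕ) : ℝ))
      (∑' n : ℕ, ((n + 1 : ℕ) : ℝ) * D.upMass (kind x) (n + 1)) :=
  hasSum_P_up hD.stochastic x (ψ := fun n => (n : ℝ)) (fun _ => Nat.cast_nonneg _) Nat.cast_zero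
    ((hD.summable_upMass (kind x)).hasSum.congr_fun fun _ => mul_comm _ _)

theorem exists_abs_increment_le (hD : D.Stable ϖ) : ∃ C : ℝ, ∀ x : State M₀ M₁,
    Summable (fun y => D.P x y * |(y.1 : ℝ) - x.1|) ∧
      ∑' y, D.P x y * |(y.1 : ℝ) - x.1| ≤ C := by
  have h0 : ∀ a, 0 ≤ ∑' n : ℕ, ((n + 1 : ℕ) : ℝ) * D.upMass a (n + 1) := fun a =>
    tsum_nonneg fun _ => mul_nonneg (Nat.cast_nonneg _) (D.upMass_nonneg hD.stochastic a _)
  refine ⟨1 + ∑ a, ∑' n : ℕ, ((n + 1 : ℕ) : ℝ) * D.upMass a (n + 1), fun x => ?_⟩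
  have h1 := (hD.stochastic.2 x).add (hD.hasSum_up x)
  have hle : ∀ y, D.P x y * |(y.1 : ℝ) - x.1| ≤ D.P x y + D.P x y * ((y.1 - x.1 : ℕ) : ℝ) :=
    fun y => by
      rcases lt_or_ge (y.1 + 1) x.1 with h | h
      · rw [D.P_eq_zero h]
        simp
      · rw [← mul_one_add]
        refine mul_le_mul_of_nonneg_left ?_ (hD.stochastic.1 x y)
        rcases le_total x.1 y.1 with h2 | h2
        · have : (x.1 : ℝ) ≤ y.1 := by exact_mod_cast h2
          rw [abs_of_nonneg (by linarith), Nat.cast_sub h2]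
          linarith
        · have h3 : (y.1 : ℝ) ≤ x.1 := by exact_mod_cast h2
          have h4 : (x.1 : ℝ) ≤ y.1 + 1 := by exact_mod_cast h
          rw [abs_of_nonpos (by linarith), Nat.sub_eq_zero_of_le h2]
          simp
          linarith
  have hs : Summable (fun y => D.P x y * |(y.1 : ℝ) - x.1|) :=
    .of_nonneg_of_le (fun y => mul_nonneg (hD.stochastic.1 x y) (abs_nonneg _)) hle h1.summable
  refine ⟨hs, (hasSum_le hle hs.hasSum h1).trans ?_⟩
  gcongr
  exact Finset.single_le_sum (f := fun a => ∑' n : ℕ, ((n + 1 : ℕ) : ℝ) * D.upMass a (n + 1))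
    (fun a _ => h0 a) (Finset.mem_univ (kind x))

end Blocks.Stable

theorem doubleTailSum_mulVec_one {m n : ℕ} {X : ℕ → Matrix (Fin m) (Fin n) ℝ}
    (h0 : ∀ k i j, 0 ≤ X (k + 1) i j) {i : Fin m} {N : ℕ}
    (hs : Summable fun k : ℕ => ((k + 1 : ℕ) : ℝ) * (X (N + 1 + k + 1) *ᵥ 1) i) :
    (doubleTailSum X N *ᵥ 1) i = ∑' k : ℕ, ((k + 1 : ℕ) : ℝ) * (X (N + 1 + k + 1) *ᵥ 1) i := by
  have hX : ∀ k, (X k *ᵥ 1) i = ∑ j, X k i j := fun k => by simp [Matrix.mulVec, dotProduct]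
  have hsj : ∀ j, Summable fun k : ℕ => ((k + 1 : ℕ) : ℝ) * X (N + 1 + k + 1) i j := fun j =>
    .of_nonneg_of_le (fun k => mul_nonneg (Nat.cast_nonneg _) (h0 _ _ _)) (fun k => by
      rw [hX]
      exact mul_le_mul_of_nonneg_left (Finset.single_le_sum
        (f := fun j => X (N + 1 + k + 1) i j) (fun j _ => h0 _ _ _) (Finset.mem_univ j))
        (Nat.cast_nonneg _)) hs
  have hj : ∀ j, doubleTailSum X N i j = ∑' k : ℕ, ((k + 1 : ℕ) : ℝ) * X (N + 1 + k + 1) i j :=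
    fun j => by
      rw [← tsum_shift_eq (fun k => h0 _ _ _) (hsj j)]
      refine tsum_congr fun l => tsum_congr fun r => ?_
      rw [show N + 1 + l + 1 + r = N + 1 + (l + r) + 1 by omega]
  have : (doubleTailSum X N *ᵥ 1) i = ∑ j, doubleTailSum X N i j := by
    simp [Matrix.mulVec, dotProduct]
  rw [this, Finset.sum_congr rfl fun j _ => hj j, ← Summable.tsum_finsetSum fun j _ => hsj j]
  exact tsum_congr fun k => by rw [hX, Finset.mul_sum]

theorem tendsto_upExcess (hD : D.Stable ϖ) {F : ℕ → ℝ} {cA : Fin M₁ → ℝ} {cB : Fin M₀ → ℝ}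
    (hF : D.HasLongTail F cA cB) (a : Fin M₀ ⊕ Fin M₁) :
    Tendsto (fun N => D.upExcess a N / (1 - F N)) atTop (𝓝 (Sum.elim cB cA a)) := by
  cases a with
  | inl i =>
    refine (hF.tendsto_B i).congr fun N => ?_
    rw [doubleTailSum_mulVec_one (fun k i j => hD.stochastic.1 (zeroState i) (succState k j))
      (hD.summable_upMass_shift (.inl i) (N + 1))]
    rfl
  | inr i =>
    refine (hF.tendsto_A i).congr fun N => ?_
    rw [doubleTailSum_mulVec_one (fun k i j => ?_) (hD.summable_upMass_shift (.inr i) (N + 1))]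
    · rfl
    · have := hD.stochastic.1 (succState 0 i) (succState (k + 1) j)
      rwa [D.P_succ_succ, if_pos (Nat.zero_le _)] at this

theorem tendsto_tail_ratio {F : ℕ → ℝ} (hF : IsLongTailed F) :
    Tendsto (fun N => (1 - F N) / (1 - F (N + 1))) atTop (𝓝 1) := by
  have := (hF.tendsto_ratio 1).inv₀ one_ne_zero
  simpa using this

/-- The truncation with parameter `N + 1` cuts off the excess over `N + 1`; by the shift
insensitivity of `F` its size may be compared with `1 - F (N + 1)` as well. -/
theorem tendsto_upExcess_succ (hD : D.Stable ϖ) {F : ℕ → ℝ} {cA : Fin M₁ → ℝ} {cB : Fin M₀ → ℝ}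
    (hF : D.HasLongTail F cA cB) (a : Fin M₀ ⊕ Fin M₁) :
    Tendsto (fun N => D.upExcess a N / (1 - F (N + 1))) atTop (𝓝 (Sum.elim cB cA a)) := by
  have := (tendsto_upExcess hD hF a).mul (tendsto_tail_ratio hF.longTailed)
  rw [mul_one] at this
  refine this.congr fun N => ?_
  have h1 := (hF.longTailed.tail_pos N).ne'
  have h2 := (hF.longTailed.tail_pos (N + 1)).ne'
  field_simp

/-- The tail is the difference of two consecutive double tails, whose ratios to the long tail of `F`
have the same limit. -/
theorem tendsto_upTail (hD : D.Stable ϖ) {F : ℕ → ℝ} {cA : Fin M₁ → ℝ} {cB : Fin M₀ → ℝ}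
    (hF : D.HasLongTail F cA cB) (a : Fin M₀ ⊕ Fin M₁) :
    Tendsto (fun N => D.upTail a N / (1 - F (N + 1))) atTop (𝓝 0) := by
  have h := (tendsto_upExcess_succ hD hF a).sub
    ((tendsto_add_atTop_iff_nat 1).2 (tendsto_upExcess hD hF a))
  rw [sub_self] at h
  refine h.congr fun N => ?_
  rw [hD.upTail_eq, sub_div]

/-! ### The drift of a linear test function -/

theorem summable_A_entry (hP : IsStochastic D.P) (i j : Fin M₁) : Summable fun n => D.A n i j := by
  have hinj : Function.Injective fun n : ℕ => (succState n j : State M₀ M₁) := fun a b hab => by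
    have : a + 1 = b + 1 := congrArg Sigma.fst hab
    omega
  refine ((hP.summable (succState 0 i)).comp_injective hinj).congr fun n => ?_
  simp [D.P_succ_succ]

/-- The phase dependent part of the test function `height v`. -/
def corrector (v : Fin M₁ → ℝ) : Fin M₀ ⊕ Fin M₁ → ℝ := Sum.elim (fun _ => 0) v

/-- The test function equal to `k + v i` in phase `i` of a level `k ≥ 1`, and to `0` in level
`0`. -/
def height (v : Fin M₁ → ℝ) (x : State M₀ M₁) : ℝ := x.1 + corrector v (kind x)

/-- The mean increment of the test function `height v` over one step of the chain. -/
def Blocks.meanIncrement (D : Blocks M₀ M₁) (v : Fin M₁ → ℝ) (x : State M₀ M₁) : ℝ :=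
  ∑' y, D.P x y * (height v y - height v x)

/-- A corrector `v` that makes the mean increment of `k + v i` constant away from the boundary. -/
theorem Blocks.Stable.exists_corrector (hD : D.Stable ϖ) (hM₁ : 1 ≤ M₁) :
    ∃ v : Fin M₁ → ℝ, (∀ i, 0 ≤ v i) ∧
      ∀ i, v i - ∑ j, D.Asum i j * v j = D.mA i - D.drift ϖ := by
  have : Nonempty (Fin M₁) := ⟨⟨0, hM₁⟩⟩
  have h0 : ϖ ⬝ᵥ (fun i => D.mA i - D.drift ϖ) = 0 := by
    have h1 := (hasSum_fintype ϖ).unique hD.stationary_A.hasSum_one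
    simp only [dotProduct, mul_sub, Finset.sum_sub_distrib, ← Finset.sum_mul, h1, one_mul]
    exact sub_self _
  obtain ⟨v, hv⟩ := exists_finite_poisson hD.stochastic_A hD.irreducible_A hD.stationary_A h0
  have hle : ∀ i, |v i| ≤ ∑ j, |v j| := fun i =>
    Finset.single_le_sum (f := fun j => |v j|) (fun j _ => abs_nonneg _) (Finset.mem_univ i)
  refine ⟨fun i => v i + ∑ j, |v j|, fun i => ?_, fun i => ?_⟩
  · linarith [neg_abs_le (v i), hle i]
  · have h1 := (hasSum_fintype _).unique (hD.stochastic_A.2 i)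
    simp only [mul_add, Finset.sum_add_distrib, ← Finset.sum_mul, h1, one_mul]
    linarith [hv i]

section Height

variable {v : Fin M₁ → ℝ}

theorem corrector_nonneg (hv : ∀ i, 0 ≤ v i) (a : Fin M₀ ⊕ Fin M₁) :
    0 ≤ corrector v a := by
  cases a with
  | inl i => exact le_rfl
  | inr i => exact hv i

theorem corrector_le (hv : ∀ i, 0 ≤ v i) (a : Fin M₀ ⊕ Fin M₁) :
    corrector v a ≤ ∑ i, v i := by
  cases a with
  | inl i => exact Finset.sum_nonneg fun i _ => hv i
  | inr i => exact Finset.single_le_sum (f := v) (fun i _ => hv i) (Finset.mem_univ i)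

theorem height_nonneg (hv : ∀ i, 0 ≤ v i) (x : State M₀ M₁) : 0 ≤ height v x :=
  add_nonneg (Nat.cast_nonneg _) (corrector_nonneg hv _)

theorem finite_height_le (hv : ∀ i, 0 ≤ v i) (c : ℝ) :
    {x : State M₀ M₁ | height v x ≤ c}.Finite := by
  refine (finite_levels_le ⌊c⌋₊).subset fun x hx => Nat.le_floor ?_
  have h1 : height v x ≤ c := hx
  have h2 := corrector_nonneg hv (kind x)
  unfold height at h1
  linarith

theorem height_cap (v : Fin M₁ → ℝ) (x z : State M₀ M₁) (N : ℕ) :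
    height v (cap (x.1 + N) z) = height v z - ((z.1 - x.1 - (N + 1) : ℕ) : ℝ) := by
  unfold height
  rw [kind_cap, cap_fst]
  have h : z.1 = min z.1 (x.1 + N + 1) + (z.1 - x.1 - (N + 1)) := by omega
  have h' : (z.1 : ℝ) = (min z.1 (x.1 + N + 1) : ℕ) + ((z.1 - x.1 - (N + 1) : ℕ) : ℝ) := by
    exact_mod_cast h
  linarith

theorem abs_height_cap_sub_le (hv : ∀ i, 0 ≤ v i) (x z : State M₀ M₁) (N : ℕ) :
    |height v (cap (x.1 + N) z) - height v x| ≤ |(z.1 : ℝ) - x.1| + ∑ i, v i := by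
  have h1 : |((cap (x.1 + N) z).1 : ℝ) - x.1| ≤ |(z.1 : ℝ) - x.1| := by
    rw [cap_fst]
    rcases le_total z.1 (x.1 + N + 1) with h | h
    · rw [min_eq_left h]
    · rw [min_eq_right h]
      have h2 : ((x.1 + N + 1 : ℕ) : ℝ) ≤ z.1 := by exact_mod_cast h
      have h3 : (x.1 : ℝ) ≤ (x.1 + N + 1 : ℕ) := by exact_mod_cast (by omega)
      rw [abs_of_nonneg (by linarith), abs_of_nonneg (by linarith)]
      linarith
  have h2 : |corrector v (kind z) - corrector v (kind x)| ≤ ∑ i, v i := by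
    rw [abs_le]
    constructor <;> linarith [corrector_nonneg hv (kind z), corrector_nonneg hv (kind x),
      corrector_le hv (kind z), corrector_le hv (kind x)]
  have h3 : height v (cap (x.1 + N) z) - height v x = (((cap (x.1 + N) z).1 : ℝ) - x.1)
      + (corrector v (kind z) - corrector v (kind x)) := by
    unfold height
    rw [kind_cap]
    ring
  rw [h3]
  exact (abs_add_le _ _).trans (add_le_add h1 h2)

theorem abs_height_sub_le (hv : ∀ i, 0 ≤ v i) (x z : State M₀ M₁) :
    |height v z - height v x| ≤ |(z.1 : ℝ) - x.1| + ∑ i, v i := by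
  have := abs_height_cap_sub_le hv x z z.1
  rwa [cap_eq_self (by omega)] at this

theorem summable_and_tsum_le_of_le {S : Type*} {Q : Matrix S S ℝ} (hQ : IsStochastic Q) {x : S}
    {f g : S → ℝ} {C V : ℝ} (hg : Summable fun y => Q x y * g y) (hgC : ∑' y, Q x y * g y ≤ C)
    (hf0 : ∀ y, 0 ≤ f y) (hf : ∀ y, f y ≤ g y + V) :
    (Summable fun y => Q x y * f y) ∧ ∑' y, Q x y * f y ≤ C + V := by
  have h1 := hg.hasSum.add ((hQ.2 x).mul_right V)
  have hle : ∀ y, Q x y * f y ≤ Q x y * g y + Q x y * V := fun y => by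
    rw [← mul_add]
    exact mul_le_mul_of_nonneg_left (hf y) (hQ.1 x y)
  have hs : Summable fun y => Q x y * f y :=
    .of_nonneg_of_le (fun y => mul_nonneg (hQ.1 x y) (hf0 y)) hle h1.summable
  refine ⟨hs, (hasSum_le hle hs.hasSum h1).trans ?_⟩
  linarith

theorem Blocks.Stable.exists_height_bound (hD : D.Stable ϖ) (hv : ∀ i, 0 ≤ v i) :
    ∃ C : ℝ, (∀ x, Summable (fun y => D.P x y * |height v y - height v x|) ∧
        ∑' y, D.P x y * |height v y - height v x| ≤ C) ∧
      ∀ N x, Summable (fun y => (D.trunc (N + 1)).P x y * |height v y - height v x|) ∧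
        ∑' y, (D.trunc (N + 1)).P x y * |height v y - height v x| ≤ C := by
  obtain ⟨C, hC⟩ := hD.exists_abs_increment_le
  refine ⟨C + ∑ i, v i, fun x => ?_, fun N x => ?_⟩
  · exact summable_and_tsum_le_of_le hD.stochastic (hC x).1 (hC x).2 (fun _ => abs_nonneg _)
      fun y => abs_height_sub_le hv x y
  · have h1 := summable_and_tsum_le_of_le hD.stochastic (hC x).1 (hC x).2
      (fun _ => abs_nonneg _) fun y => abs_height_cap_sub_le hv x y N
    have h2 := hasSum_trunc_mul hD.stochastic N x (f := fun y => |height v y - height v x|) h1.1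
    exact ⟨h2.summable, h2.tsum_eq.trans_le h1.2⟩

theorem summable_mul_of_summable_mul_abs {S : Type*} {Q : Matrix S S ℝ} (hQ : IsStochastic Q)
    {x : S} {f : S → ℝ} (h : Summable fun y => Q x y * |f y|) : Summable fun y => Q x y * f y := by
  refine .of_norm_bounded h fun y => ?_
  rw [Real.norm_eq_abs, abs_mul, abs_of_nonneg (hQ.1 x y)]

theorem Blocks.Stable.hasSum_meanIncrement (hD : D.Stable ϖ) (hv : ∀ i, 0 ≤ v i)
    (x : State M₀ M₁) :
    HasSum (fun y => D.P x y * (height v y - height v x)) (D.meanIncrement v x) := by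
  obtain ⟨C, hC, _⟩ := hD.exists_height_bound hv
  exact (summable_mul_of_summable_mul_abs hD.stochastic (hC x).1).hasSum

/-- Truncation lowers the mean increment by the mean excess that it cuts off, whatever the
level. -/
theorem Blocks.Stable.hasSum_trunc_increment (hD : D.Stable ϖ) (hv : ∀ i, 0 ≤ v i) (N : ℕ)
    (x : State M₀ M₁) :
    HasSum (fun y => (D.trunc (N + 1)).P x y * (height v y - height v x))
      (D.meanIncrement v x - D.upExcess (kind x) N) := by
  have h1 : HasSum (fun z => D.P x z * (height v (cap (x.1 + N) z) - height v x))
      (D.meanIncrement v x - D.upExcess (kind x) N) := by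
    refine ((hD.hasSum_meanIncrement hv x).sub (hD.hasSum_up_excess x N)).congr_fun fun z => ?_
    rw [height_cap]
    ring
  rw [← h1.tsum_eq]
  exact hasSum_trunc_mul hD.stochastic N x (f := fun y => height v y - height v x) h1.summable

/-- From a level `≥ 2` no jump reaches level `0`, so that the test function agrees with `k + v i` on
all states involved, and the choice of `v` makes the phase dependent parts cancel. -/
theorem Blocks.Stable.meanIncrement_eq (hD : D.Stable ϖ) (hv : ∀ i, 0 ≤ v i)
    (hvA : ∀ i, v i - ∑ j, D.Asum i j * v j = D.mA i - D.drift ϖ) {x : State M₀ M₁}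
    (hx : 2 ≤ x.1) : D.meanIncrement v x = D.drift ϖ := by
  induction x using state_cases with
  | zero i => simp at hx
  | succ k i =>
  obtain ⟨k, rfl⟩ : ∃ m, k = m + 1 := ⟨k - 1, by simp at hx; omega⟩
  have h1 := hasSum_levels (hD.hasSum_meanIncrement hv (succState (k + 1) i))
  -- the contribution of the levels `≥ k + 2`
  have hA : HasSum (fun n : ℕ => ∑ j, D.A n i j * (n + v j - v i))
      (∑' n : ℕ, (n : ℝ) * (D.A n *ᵥ 1) i + ∑ j, (∑' n, D.A n i j) * (v j - v i)) := by
    refine ((hD.summable_A i).hasSum.add (hasSum_sum fun j _ =>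
      (summable_A_entry hD.stochastic i j).hasSum.mul_right (v j - v i))).congr_fun fun n => ?_
    simp only [Matrix.mulVec, dotProduct, Pi.one_apply, mul_one, Finset.mul_sum]
    rw [← Finset.sum_add_distrib]
    exact Finset.sum_congr rfl fun j _ => by ring
  let L : ℕ → ℝ := fun l => ∑ j, D.P (succState (k + 1) i) ⟨l, j⟩ *
      (height v ⟨l, j⟩ - height v (succState (k + 1) i : State M₀ M₁))
  have hL : ∀ l, L (l + 1) = ∑ j, (if k + 1 ≤ l then D.A (l - (k + 1)) i j else
      if l + 1 = k + 1 then D.Am1 i j else 0) * ((l : ℝ) - (k + 1) + v j - v i) := fun l => by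
    change ∑ j : Fin M₁, D.P (succState (k + 1) i) (succState l j) *
      (height v (succState l j : State M₀ M₁) - height v (succState (k + 1) i : State M₀ M₁)) = _
    refine Finset.sum_congr rfl fun j _ => ?_
    rw [D.P_succ_succ]
    congr 1
    simp only [height, succState_fst, kind_succState, corrector, Sum.elim_inr]
    push_cast
    ring
  have hL0 : ∀ l < k + 1, L l = 0 := fun l hl => Finset.sum_eq_zero fun j _ => by
    rw [D.P_eq_zero (show l + 1 < k + 1 + 1 by omega), zero_mul]
  have hL1 : L (k + 1) = ∑ j, D.Am1 i j * (-1 + v j - v i) := by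
    rw [hL]
    refine Finset.sum_congr rfl fun j _ => ?_
    rw [if_neg (by omega), if_pos rfl]
    ring
  have hL2 : HasSum (fun n => L (n + (k + 2)))
      (∑' n : ℕ, (n : ℝ) * (D.A n *ᵥ 1) i + ∑ j, (∑' n, D.A n i j) * (v j - v i)) := by
    refine hA.congr_fun fun n => ?_
    rw [show n + (k + 2) = n + (k + 1) + 1 by omega, hL]
    refine Finset.sum_congr rfl fun j _ => ?_
    rw [if_pos (by omega), Nat.add_sub_cancel]
    push_cast
    ring
  have h3 := (hasSum_nat_add_iff (k + 2)).1 hL2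
  have h4 := h1.unique h3
  rw [h4, Finset.sum_range_succ, Finset.sum_eq_zero fun l hl => hL0 l (Finset.mem_range.1 hl),
    hL1, zero_add]
  have h5 := (hasSum_fintype _).unique (hD.stochastic_A.2 i)
  have h6 := hvA i
  have h7 : D.mA i = -(∑ j, D.Am1 i j) + ∑' n : ℕ, (n : ℝ) * (D.A n *ᵥ 1) i := by
    simp [Blocks.mA, Matrix.mulVec, dotProduct]
  have h8 : ∑ j, D.Asum i j * v j
      = ∑ j, D.Am1 i j * v j + ∑ j, (∑' n, D.A n i j) * v j := by
    rw [← Finset.sum_add_distrib]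
    exact Finset.sum_congr rfl fun j _ => add_mul _ _ _
  have h9 : ∑ j, D.Am1 i j + ∑ j, (∑' n, D.A n i j) = 1 := by
    rw [← Finset.sum_add_distrib]
    exact h5
  have h10 : ∑ j, D.Am1 i j * (-1 + v j - v i)
      = -(∑ j, D.Am1 i j) + ∑ j, D.Am1 i j * v j - (∑ j, D.Am1 i j) * v i := by
    simp only [mul_sub, mul_add, Finset.sum_sub_distrib, Finset.sum_add_distrib, Finset.sum_mul]
    simp
  have h11 : ∑ j, (∑' n, D.A n i j) * (v j - v i)
      = ∑ j, (∑' n, D.A n i j) * v j - (∑ j, (∑' n, D.A n i j)) * v i := by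
    simp only [mul_sub, Finset.sum_sub_distrib, Finset.sum_mul]
  rw [h10, h11]
  linear_combination -h6 - h7 - h8 - v i * h9

end Height

/-! ### Stationary distributions of the chain and of its truncations -/

theorem expect_eq_add_increment {S : Type*} {Q : Matrix S S ℝ} (hQ : IsStochastic Q) {h : S → ℝ}
    {x : S} {m : ℝ} (hm : HasSum (fun y => Q x y * (h y - h x)) m) :
    HasSum (fun y => Q x y * h y) (h x + m) := by
  have := ((hQ.2 x).mul_right (h x)).add hm
  rw [one_mul] at this
  exact this.congr_fun fun y => by ring

namespace Blocks.Stable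

/-- A stochastic matrix whose mean increments of `height v` are dominated by those of `P` has a
stationary distribution. -/
theorem exists_isStationary_of_le (hD : D.Stable ϖ) (hM₀ : 1 ≤ M₀) (hM₁ : 1 ≤ M₁)
    {Q : Matrix (State M₀ M₁) (State M₀ M₁) ℝ} (hQ : IsStochastic Q)
    (hle : ∀ v : Fin M₁ → ℝ, (∀ i, 0 ≤ v i) → ∀ x, ∃ m ≤ D.meanIncrement v x,
      HasSum (fun y => Q x y * (height v y - height v x)) m) :
    ∃ p, IsStationary Q p := by
  obtain ⟨v, hv, hvA⟩ := hD.exists_corrector hM₁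
  obtain ⟨C, hC, _⟩ := hD.exists_height_bound hv
  have : Nonempty (State M₀ M₁) := ⟨zeroState ⟨0, hM₀⟩⟩
  have hmC : ∀ x, D.meanIncrement v x ≤ C := fun x => by
    refine (hasSum_le (fun y => ?_) (hD.hasSum_meanIncrement hv x) (hC x).1.hasSum).trans (hC x).2
    exact mul_le_mul_of_nonneg_left (le_abs_self _) (hD.stochastic.1 x y)
  have hC0 : 0 ≤ C := (tsum_nonneg fun y => mul_nonneg (hD.stochastic.1 _ y) (abs_nonneg _)).trans
    (hC (zeroState ⟨0, hM₀⟩)).2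
  have hσ := hD.drift_neg
  refine exists_isStationary_of_drift hQ (height_nonneg hv) (ε := -D.drift ϖ)
    (K := C + -D.drift ϖ) (C := (finite_levels_le 1).toFinset) (by linarith) (by linarith)
    (fun x => ?_) fun x => ?_
  · obtain ⟨m, -, hm⟩ := hle v hv x
    exact (expect_eq_add_increment hQ hm).summable
  · obtain ⟨m, hmle, hm⟩ := hle v hv x
    rw [expect, (expect_eq_add_increment hQ hm).tsum_eq]
    by_cases hx : x.1 ≤ 1
    · rw [Set.indicator_of_mem (by simpa using hx)]
      linarith [hmC x]
    · rw [Set.indicator_of_notMem (by simpa using hx)]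
      rw [hD.meanIncrement_eq hv hvA (by omega)] at hmle
      linarith

theorem exists_isStationary (hD : D.Stable ϖ) (hM₀ : 1 ≤ M₀) (hM₁ : 1 ≤ M₁) :
    ∃ p, IsStationary D.P p :=
  hD.exists_isStationary_of_le hM₀ hM₁ hD.stochastic fun _ hv x =>
    ⟨_, le_rfl, hD.hasSum_meanIncrement hv x⟩

theorem exists_isStationary_trunc (hD : D.Stable ϖ) (hM₀ : 1 ≤ M₀) (hM₁ : 1 ≤ M₁) (N : ℕ) :
    ∃ p, IsStationary (D.trunc (N + 1)).P p :=
  hD.exists_isStationary_of_le hM₀ hM₁ (isStochastic_trunc hD.stochastic N) fun _ hv x =>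
    ⟨_, sub_le_self _ (hD.upExcess_nonneg _ _), hD.hasSum_trunc_increment hv N x⟩

/-- A path of positive probability survives the truncation for large `N`, since the truncation does
not lower the entries in the columns of levels at most `N + 1`. -/
theorem eventually_transGen_trunc (hD : D.Stable ϖ) {x y : State M₀ M₁}
    (h : Relation.TransGen (Step D.P) x y) :
    ∀ᶠ N in atTop, Relation.TransGen (Step (D.trunc (N + 1)).P) x y := by
  have hstep : ∀ {a b}, Step D.P a b → ∀ᶠ N in atTop, Step (D.trunc (N + 1)).P a b :=
    fun {a b} hab => by
      filter_upwards [eventually_ge_atTop b.1] with N hN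
      exact lt_of_lt_of_le hab (P_le_trunc_P hD.stochastic (by omega))
  induction h with
  | single h => exact (hstep h).mono fun N hN => .single hN
  | tail _ h ih =>
    filter_upwards [ih, hstep h] with N h1 h2
    exact .tail h1 h2

/-- For large `N` every state of the truncated chain leads to a given state `α`: the negative drift
brings the chain down to the levels `0` and `1`, uniformly in `N`, and the finitely many paths of
positive probability from there to `α` survive the truncation. -/
theorem eventually_reach_trunc (hD : D.Stable ϖ) (hM₁ : 1 ≤ M₁) (α : State M₀ M₁) :
    ∀ᶠ N in atTop, ∀ x, Relation.TransGen (Step (D.trunc (N + 1)).P) x α := by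
  obtain ⟨v, hv, hvA⟩ := hD.exists_corrector hM₁
  have h1 : ∀ᶠ N in atTop, ∀ x ∈ {x : State M₀ M₁ | x.1 ≤ 1},
      Relation.TransGen (Step (D.trunc (N + 1)).P) x α :=
    (finite_levels_le 1).eventually_all.2 fun x _ =>
      hD.eventually_transGen_trunc (transGen_step_of_isIrreducible hD.irreducible x α)
  filter_upwards [h1] with N hN x
  have hQ := isStochastic_trunc hD.stochastic N
  have he := fun x => expect_eq_add_increment hQ (hD.hasSum_trunc_increment hv N x)
  obtain ⟨y, hy, hxy⟩ := exists_reflTransGen_of_drift hQ (C := {x : State M₀ M₁ | x.1 ≤ 1})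
    (finite_height_le hv) (fun x => (he x).summable) (fun x hx => by
      have hx' : ¬ x.1 ≤ 1 := hx
      rw [expect, (he x).tsum_eq, hD.meanIncrement_eq hv hvA (by omega)]
      linarith [hD.drift_neg, hD.upExcess_nonneg (kind x) N]) x
  exact .trans_right hxy (hN y hy)

/-! ### Comparison of the stationary distributions -/

/-- Up to an error of the order of the probability of a truncated jump, the stationary
distributions of the truncated chains are proportional to that of the original chain. -/
theorem exists_abs_sub_mul_le (hD : D.Stable ϖ) (z α : State M₀ M₁) :
    ∃ L ρ : ℝ, (∀ p, IsStationary D.P p → p z = ρ * p α) ∧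
      ∀ N q, IsStationary (D.trunc (N + 1)).P q →
        |q z - ρ * q α| ≤ L * ∑ a, D.upTail a N := by
  classical
  have hreach := transGen_step_of_isIrreducible hD.irreducible
  obtain ⟨b, K, ρ, hb, hbe⟩ := exists_bounded_poisson hD.stochastic (hreach z α) (hreach α α)
  have hK : 0 ≤ K := (abs_nonneg _).trans (hb α)
  have hval : ∀ q : State M₀ M₁ → ℝ,
      HasSum (fun x => q x * (b x - expect D.P b x)) (q z - ρ * q α) := fun q => by
    have h2 := (hasSum_ite_eq z (q z)).sub ((hasSum_ite_eq α (q α)).mul_left ρ)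
    refine h2.congr_fun fun x => ?_
    rw [hbe]
    split_ifs <;> simp_all <;> ring
  refine ⟨2 * K, ρ, fun p hp => ?_, fun N q hq => ?_⟩
  · have := (hval p).unique (hp.hasSum_mul_sub_expect hD.stochastic hb)
    linarith
  · have hQ := isStochastic_trunc hD.stochastic N
    have h1 := (hval q).sub (hq.hasSum_mul_sub_expect hQ hb)
    rw [sub_zero] at h1
    have h2 : HasSum (fun x => q x * (2 * K * ∑ a, D.upTail a N))
        (1 * (2 * K * ∑ a, D.upTail a N)) := hq.hasSum_one.mul_right _
    rw [one_mul] at h2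
    rw [← h1.tsum_eq, ← Real.norm_eq_abs]
    refine tsum_of_norm_bounded h2 fun x => ?_
    have h3 : expect (D.trunc (N + 1)).P b x - expect D.P b x
        = ∑' w, D.P x w * (b (cap (x.1 + N) w) - b w) := by
      have ha := summable_mul_of_abs_le (hD.stochastic.1 x) (hD.stochastic.summable x)
        (f := fun w => b (cap (x.1 + N) w)) fun w => hb _
      have hb' := summable_mul_of_abs_le (hD.stochastic.1 x) (hD.stochastic.summable x) hb
      rw [expect, (hasSum_trunc_mul hD.stochastic N x ha).tsum_eq, expect, ← ha.tsum_sub hb']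
      exact tsum_congr fun w => by ring
    have h4 : |expect (D.trunc (N + 1)).P b x - expect D.P b x|
        ≤ D.upTail (kind x) N * (2 * K) := by
      rw [h3, ← Real.norm_eq_abs]
      refine tsum_of_norm_bounded ((hD.hasSum_up_tail x N).mul_right (2 * K)) fun w => ?_
      rw [norm_mul, Real.norm_eq_abs, Real.norm_eq_abs, abs_of_nonneg (hD.stochastic.1 x w),
        mul_assoc]
      refine mul_le_mul_of_nonneg_left ?_ (hD.stochastic.1 x w)
      split_ifs with hw
      · refine (abs_sub _ _).trans ?_
        linarith [hb (cap (x.1 + N) w), hb w]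
      · rw [cap_eq_self (by omega), sub_self, abs_zero, zero_mul]
    have h5 : D.upTail (kind x) N ≤ ∑ a, D.upTail a N :=
      Finset.single_le_sum (f := fun a => D.upTail a N) (fun a _ => hD.upTail_nonneg a N)
        (Finset.mem_univ _)
    rw [← mul_sub, norm_mul, Real.norm_eq_abs, Real.norm_eq_abs, abs_of_nonneg (hq.nonneg x)]
    refine mul_le_mul_of_nonneg_left ?_ (hq.nonneg x)
    rw [show b x - expect D.P b x - (b x - expect (D.trunc (N + 1)).P b x)
      = expect (D.trunc (N + 1)).P b x - expect D.P b x by ring]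
    calc _ ≤ _ := h4
      _ ≤ (∑ a, D.upTail a N) * (2 * K) := by gcongr
      _ = _ := mul_comm _ _

theorem abs_upExcess_le (hD : D.Stable ϖ) (a : Fin M₀ ⊕ Fin M₁) (N : ℕ) :
    |D.upExcess a N| ≤ ∑ a, D.upExcess a N := by
  rw [abs_of_nonneg (hD.upExcess_nonneg a N)]
  exact Finset.single_le_sum (f := fun a => D.upExcess a N) (fun a _ => hD.upExcess_nonneg a N)
    (Finset.mem_univ _)

/-- The balance of mean increments of the linear test function, for the original and for the
truncated chain. Off the levels `0` and `1` the mean increment is the drift, so it determines the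
stationary mass near the boundary, and the truncated excess enters as the perturbation. -/
theorem exists_abs_sub_mul_sub_excess_le (hD : D.Stable ϖ) (hM₁ : 1 ≤ M₁) {p : State M₀ M₁ → ℝ}
    (hp : IsStationary D.P p) (x : State M₀ M₁) :
    ∃ E M : ℝ, p x * E = -D.drift ϖ ∧ ∀ N q, IsStationary (D.trunc (N + 1)).P q →
      |(q x - p x) * E - ∑' y, q y * D.upExcess (kind y) N| ≤ M * ∑ a, D.upTail a N := by
  obtain ⟨v, hv, hvA⟩ := hD.exists_corrector hM₁
  obtain ⟨C, hC, hC'⟩ := hD.exists_height_bound hv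
  choose L ρ hρ hq using fun z => hD.exists_abs_sub_mul_le z x
  -- the mean increment minus the drift, which lives on the levels `0` and `1`
  set B : Finset (State M₀ M₁) := (finite_levels_le 1).toFinset with hB
  set e : State M₀ M₁ → ℝ := fun y => D.meanIncrement v y - D.drift ϖ with he
  have he0 : ∀ y ∉ B, e y = 0 := fun y hy => by
    have : ¬ y.1 ≤ 1 := by simpa [hB] using hy
    simp only [he, hD.meanIncrement_eq hv hvA (show 2 ≤ y.1 by omega), sub_self]
  have hsum : ∀ r : State M₀ M₁ → ℝ, HasSum (fun y => r y * e y) (∑ y ∈ B, r y * e y) := fun r =>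
    hasSum_sum_of_ne_finset_zero fun y hy => by rw [he0 y hy, mul_zero]
  have hpE : p x * ∑ y ∈ B, ρ y * e y = -D.drift ϖ := by
    have h1 := hp.hasSum_mul_increment hD.stochastic (fun x => (hC x).1) fun x => (hC x).2
    have h2 := (hsum p).add (hp.hasSum_one.mul_right (D.drift ϖ))
    have h3 := h2.unique (h1.congr_fun fun y => ?_)
    · rw [Finset.mul_sum]
      have h4 : ∑ y ∈ B, p x * (ρ y * e y) = ∑ y ∈ B, p y * e y :=
        Finset.sum_congr rfl fun y _ => by rw [hρ y p hp]; ring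
      linarith
    · simp only [he, Blocks.meanIncrement]
      ring
  refine ⟨∑ y ∈ B, ρ y * e y, ∑ y ∈ B, L y * |e y|, hpE, fun N q hqs => ?_⟩
  have hQ := isStochastic_trunc hD.stochastic N
  have hsN : Summable fun y => q y * D.upExcess (kind y) N :=
    summable_mul_of_abs_le hqs.nonneg hqs.summable fun y => hD.abs_upExcess_le (kind y) N
  have h1 := hqs.hasSum_mul_increment hQ (fun x => (hC' N x).1) fun x => (hC' N x).2
  have h2 := ((hsum q).add (hqs.hasSum_one.mul_right (D.drift ϖ))).sub hsN.hasSum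
  have h3 := h2.unique (h1.congr_fun fun y => ?_)
  · have h4 : (q x - p x) * ∑ y ∈ B, ρ y * e y - ∑' y, q y * D.upExcess (kind y) N
        = -∑ y ∈ B, (q y - ρ y * q x) * e y := by
      have h5 : ∑ y ∈ B, (q y - ρ y * q x) * e y
          = ∑ y ∈ B, q y * e y - q x * ∑ y ∈ B, ρ y * e y := by
        rw [Finset.mul_sum, ← Finset.sum_sub_distrib]
        exact Finset.sum_congr rfl fun y _ => by ring
      rw [h5, sub_mul, hpE]
      linarith
    rw [h4, abs_neg, Finset.sum_mul]
    refine (Finset.abs_sum_le_sum_abs _ _).trans (Finset.sum_le_sum fun y _ => ?_)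
    rw [abs_mul, mul_right_comm]
    exact mul_le_mul_of_nonneg_right (hq y N q hqs) (abs_nonneg _)
  · rw [(hD.hasSum_trunc_increment hv N y).tsum_eq]
    simp only [he]
    ring

end Blocks.Stable

/-! ### The limit of the scaled difference -/

/-- Pointwise convergence of probability vectors implies weak convergence, by Scheffé's lemma. -/
theorem tendsto_tsum_mul_of_tendsto {S : Type*} {p : S → ℝ} {q : ℕ → S → ℝ} (hp0 : ∀ x, 0 ≤ p x)
    (hp : HasSum p 1) (hq0 : ∀ n x, 0 ≤ q n x) (hq : ∀ n, HasSum (q n) 1)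
    (hlim : ∀ x, Tendsto (fun n => q n x) atTop (𝓝 (p x))) {f : S → ℝ} {K : ℝ}
    (hf : ∀ x, |f x| ≤ K) :
    Tendsto (fun n => ∑' x, q n x * f x) atTop (𝓝 (∑' x, p x * f x)) := by
  have h1 : Tendsto (fun n => ∑' x, max (p x - q n x) 0) atTop (𝓝 (∑' _ : S, (0 : ℝ))) := by
    refine tendsto_tsum_of_dominated_convergence hp.summable (fun x => ?_)
      (.of_forall fun n x => ?_)
    · have := ((hlim x).const_sub (p x)).max (tendsto_const_nhds (x := (0 : ℝ)))
      simpa using this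
    · rw [Real.norm_eq_abs, abs_of_nonneg (le_max_right _ _)]
      exact max_le (by linarith [hq0 n x]) (hp0 x)
  rw [tsum_zero] at h1
  rw [tendsto_iff_norm_sub_tendsto_zero]
  refine squeeze_zero (fun _ => norm_nonneg _) (fun n => ?_) (by simpa using h1.mul_const (2 * K))
  have hs : Summable fun x => max (p x - q n x) 0 :=
    .of_nonneg_of_le (fun x => le_max_right _ _)
      (fun x => max_le (by linarith [hq0 n x]) (hp0 x)) hp.summable
  have h2 : HasSum (fun x => |q n x - p x|) (2 * ∑' x, max (p x - q n x) 0) := by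
    have := (hs.hasSum.mul_left 2).add ((hq n).sub hp)
    rw [sub_self, add_zero] at this
    refine this.congr_fun fun x => ?_
    rcases le_total (p x) (q n x) with h | h
    · rw [max_eq_right (by linarith), abs_of_nonneg (by linarith)]
      ring
    · rw [max_eq_left (by linarith), abs_of_nonpos (by linarith)]
      ring
  have h3 := (summable_mul_of_abs_le (hq0 n) (hq n).summable hf).tsum_sub
    (summable_mul_of_abs_le hp0 hp.summable hf)
  rw [← h3]
  refine (tsum_of_norm_bounded (h2.mul_right K) fun x => ?_).trans (le_of_eq (by ring))
  rw [← sub_mul, norm_mul, Real.norm_eq_abs, Real.norm_eq_abs]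
  exact mul_le_mul_of_nonneg_left (hf x) (abs_nonneg _)

theorem abs_le_sum_abs (c : Fin M₀ ⊕ Fin M₁ → ℝ) (a : Fin M₀ ⊕ Fin M₁) : |c a| ≤ ∑ a, |c a| :=
  Finset.single_le_sum (f := fun a => |c a|) (fun _ _ => abs_nonneg _) (Finset.mem_univ a)

theorem tsum_mul_elim_kind {p : State M₀ M₁ → ℝ} (hp0 : ∀ x, 0 ≤ p x) (hp : Summable p)
    (cA : Fin M₁ → ℝ) (cB : Fin M₀ → ℝ) :
    ∑' y, p y * Sum.elim cB cA (kind y)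
      = (level p 0 : Fin M₀ → ℝ) ⬝ᵥ cB + upperLevels p ⬝ᵥ cA := by
  have h1 := hasSum_levels (summable_mul_of_abs_le hp0 hp
    (f := fun y : State M₀ M₁ => Sum.elim cB cA (kind y)) fun y => abs_le_sum_abs _ _).hasSum
  have hs : ∀ j, Summable fun l => p (succState l j) := fun j =>
    hp.comp_injective fun a b hab => by
      have : a + 1 = b + 1 := congrArg Sigma.fst hab
      omega
  have h2 : HasSum (fun l => ∑ j, p (succState l j) * cA j) (upperLevels p ⬝ᵥ cA) :=
    hasSum_sum fun j _ => (hs j).hasSum.mul_right (cA j)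
  have h3 := h1.unique ((hasSum_nat_add_iff 1).1 (h2.congr_fun fun l => rfl))
  rw [h3, Finset.sum_range_one, add_comm]
  rfl

section Limit

variable {F : ℕ → ℝ} {cA : Fin M₁ → ℝ} {cB : Fin M₀ → ℝ} {p : State M₀ M₁ → ℝ}
  {q : ℕ → State M₀ M₁ → ℝ}

theorem tendsto_sum_upTail (hD : D.Stable ϖ) (hF : D.HasLongTail F cA cB) :
    Tendsto (fun N => (∑ a, D.upTail a N) / (1 - F (N + 1))) atTop (𝓝 0) := by
  have := tendsto_finsetSum Finset.univ fun a _ => tendsto_upTail hD hF a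
  simpa only [Finset.sum_div, Finset.sum_const_zero] using this

theorem tendsto_apply_trunc (hD : D.Stable ϖ) (hF : D.HasLongTail F cA cB) (hM₁ : 1 ≤ M₁)
    (hp : IsStationary D.P p) (hq : ∀ N, IsStationary (D.trunc (N + 1)).P (q N))
    (x : State M₀ M₁) : Tendsto (fun N => q N x) atTop (𝓝 (p x)) := by
  obtain ⟨E, M, hE, h⟩ := hD.exists_abs_sub_mul_sub_excess_le hM₁ hp x
  have hE0 : E ≠ 0 := fun h0 => by
    rw [h0, mul_zero] at hE
    linarith [hD.drift_neg]
  have hG0 : Tendsto (fun N => 1 - F (N + 1)) atTop (𝓝 0) := by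
    have := (hF.longTailed.isDistributionFunction.tendsto_one.const_sub 1)
    rw [sub_self] at this
    exact (tendsto_add_atTop_iff_nat 1).2 this
  have hG : ∀ N, 1 - F (N + 1) ≠ 0 := fun N => (hF.longTailed.tail_pos _).ne'
  have hT : Tendsto (fun N => ∑ a, D.upTail a N) atTop (𝓝 0) := by
    have := (tendsto_sum_upTail hD hF).mul hG0
    rw [zero_mul] at this
    exact this.congr fun N => div_mul_cancel₀ _ (hG N)
  have hX : Tendsto (fun N => ∑ a, D.upExcess a N) atTop (𝓝 0) := by
    have := tendsto_finsetSum Finset.univ fun a (_ : a ∈ Finset.univ) =>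
      (tendsto_upExcess_succ hD hF a).mul hG0
    simp only [mul_zero, Finset.sum_const_zero] at this
    exact this.congr fun N => Finset.sum_congr rfl fun a _ => div_mul_cancel₀ _ (hG N)
  have h1 : Tendsto (fun N => (q N x - p x) * E) atTop (𝓝 0) := by
    refine squeeze_zero_norm (a := fun N => M * ∑ a, D.upTail a N + ∑ a, D.upExcess a N)
      (fun N => ?_) (by simpa using (hT.const_mul M).add hX)
    have h2 := h N (q N) (hq N)
    have h3 := abs_tsum_mul_le (hq N).nonneg (hq N).summable fun y =>
      hD.abs_upExcess_le (kind y) N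
    rw [(hq N).hasSum_one.tsum_eq, one_mul] at h3
    rw [Real.norm_eq_abs]
    have h4 := abs_add_le ((q N x - p x) * E - ∑' y, q N y * D.upExcess (kind y) N)
      (∑' y, q N y * D.upExcess (kind y) N)
    rw [sub_add_cancel] at h4
    linarith
  have h2 := (h1.div_const E).add_const (p x)
  rw [zero_div, zero_add] at h2
  refine h2.congr fun N => ?_
  rw [mul_div_cancel_right₀ _ hE0, sub_add_cancel]

/-- The stationary mean of the truncated excess is of the order of the tail of `F`: the phases are
finitely many, so the scaled excess converges uniformly, and the laws converge weakly. -/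
theorem tendsto_scaled_excess (hD : D.Stable ϖ) (hF : D.HasLongTail F cA cB) (hM₁ : 1 ≤ M₁)
    (hp : IsStationary D.P p) (hq : ∀ N, IsStationary (D.trunc (N + 1)).P (q N)) :
    Tendsto (fun N => (∑' y, q N y * D.upExcess (kind y) N) / (1 - F (N + 1))) atTop
      (𝓝 (∑' y, p y * Sum.elim cB cA (kind y))) := by
  set c : Fin M₀ ⊕ Fin M₁ → ℝ := Sum.elim cB cA with hc
  have h1 := tendsto_tsum_mul_of_tendsto hp.nonneg hp.hasSum_one (fun n => (hq n).nonneg)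
    (fun n => (hq n).hasSum_one) (tendsto_apply_trunc hD hF hM₁ hp hq)
    (f := fun y => c (kind y)) fun y => abs_le_sum_abs c (kind y)
  let d : ℕ → Fin M₀ ⊕ Fin M₁ → ℝ := fun N a => D.upExcess a N / (1 - F (N + 1)) - c a
  have h2 : Tendsto (fun N => ∑ a, |d N a|) atTop (𝓝 0) := by
    have := tendsto_finsetSum Finset.univ fun a (_ : a ∈ Finset.univ) =>
      ((tendsto_upExcess_succ hD hF a).sub_const (c a)).abs
    simpa only [← hc, sub_self, abs_zero, Finset.sum_const_zero] using this
  have h3 : Tendsto (fun N => ∑' y, q N y * d N (kind y)) atTop (𝓝 0) := by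
    refine squeeze_zero_norm (fun N => ?_) h2
    have := abs_tsum_mul_le (hq N).nonneg (hq N).summable
      (f := fun y => d N (kind y)) fun y => abs_le_sum_abs (d N) (kind y)
    rwa [(hq N).hasSum_one.tsum_eq, one_mul] at this
  have h4 := h1.add h3
  rw [add_zero] at h4
  refine h4.congr fun N => ?_
  rw [← (summable_mul_of_abs_le (hq N).nonneg (hq N).summable
    fun y => abs_le_sum_abs c (kind y)).tsum_add (summable_mul_of_abs_le (hq N).nonneg
      (hq N).summable fun y => abs_le_sum_abs (d N) (kind y)), ← tsum_div_const]
  refine tsum_congr fun y => ?_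
  simp only [d]
  ring

theorem tendsto_scaled_difference (hD : D.Stable ϖ) (hF : D.HasLongTail F cA cB) (hM₁ : 1 ≤ M₁)
    (hp : IsStationary D.P p) (hq : ∀ N, IsStationary (D.trunc (N + 1)).P (q N))
    (x : State M₀ M₁) :
    Tendsto (fun N => (q N x - p x) / (1 - F (N + 1))) atTop
      (𝓝 (limitConst (D.drift ϖ) p cA cB * p x)) := by
  obtain ⟨E, M, hE, h⟩ := hD.exists_abs_sub_mul_sub_excess_le hM₁ hp x
  have hσ := hD.drift_neg
  have hE0 : E ≠ 0 := fun h0 => by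
    rw [h0, mul_zero] at hE
    linarith
  have hG : ∀ N, 0 < 1 - F (N + 1) := fun N => hF.longTailed.tail_pos _
  have h1 : Tendsto (fun N => ((q N x - p x) * E - ∑' y, q N y * D.upExcess (kind y) N)
      / (1 - F (N + 1))) atTop (𝓝 0) := by
    refine squeeze_zero_norm (a := fun N => M * ((∑ a, D.upTail a N) / (1 - F (N + 1))))
      (fun N => ?_) (by simpa using (tendsto_sum_upTail hD hF).const_mul M)
    rw [norm_div, Real.norm_eq_abs, Real.norm_eq_abs, abs_of_pos (hG N), ← mul_div_assoc]
    exact div_le_div_of_nonneg_right (h N (q N) (hq N)) (hG N).le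
  have h2 := (h1.add (tendsto_scaled_excess hD hF hM₁ hp hq)).div_const E
  have h3 : (0 + ∑' y, p y * Sum.elim cB cA (kind y)) / E
      = limitConst (D.drift ϖ) p cA cB * p x := by
    rw [tsum_mul_elim_kind hp.nonneg hp.summable, limitConst, ← hE]
    have hpx : p x ≠ 0 := fun h0 => by
      rw [h0, zero_mul] at hE
      linarith
    field_simp
    ring
  rw [h3] at h2
  refine h2.congr fun N => ?_
  rw [← add_div, sub_add_cancel]
  field_simp

theorem limitConst_pos (hD : D.Stable ϖ) (hF : D.HasLongTail F cA cB)
    (hp : IsStationary D.P p) : 0 < limitConst (D.drift ϖ) p cA cB := by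
  have hpos := hp.pos hD.stochastic (transGen_step_of_isIrreducible hD.irreducible)
  have hc0 : ∀ a, 0 ≤ (Sum.elim cB cA a : ℝ) := by
    rintro (i | i)
    exacts [hF.nonneg_cB i, hF.nonneg_cA i]
  have hex : ∃ y : State M₀ M₁, 0 < (Sum.elim cB cA (kind y) : ℝ) := by
    rcases hF.ne_zero with h | h
    · obtain ⟨i, hi⟩ := Function.ne_iff.1 h
      exact ⟨succState 0 i, (hF.nonneg_cA i).lt_of_ne' hi⟩
    · obtain ⟨i, hi⟩ := Function.ne_iff.1 h
      exact ⟨zeroState i, (hF.nonneg_cB i).lt_of_ne' hi⟩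
  obtain ⟨y, hy⟩ := hex
  have h1 := (summable_mul_of_abs_le hp.nonneg hp.summable
    (f := fun y : State M₀ M₁ => Sum.elim cB cA (kind y)) fun y => abs_le_sum_abs _ _).tsum_pos
      (fun y => mul_nonneg (hp.nonneg y) (hc0 _)) y (mul_pos (hpos y) hy)
  rw [tsum_mul_elim_kind hp.nonneg hp.summable] at h1
  exact div_pos h1 (by linarith [hD.drift_neg])

end Limit

end MG1

end

theorem theorem5p1 {M₀ M₁ : ℕ} (hM₀ : 1 ≤ M₀) (hM₁ : 1 ≤ M₁) (D : MG1.Blocks M₀ M₁)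
    (ϖ : Fin M₁ → ℝ) (hD : D.Stable ϖ)
    (F : ℕ → ℝ) (cA : Fin M₁ → ℝ) (cB : Fin M₀ → ℝ) (hF : D.HasLongTail F cA cB) :
    (∃! p : MG1.State M₀ M₁ → ℝ, MG1.IsStationary D.P p) ∧
    (∀ N : ℕ, 1 ≤ N → ∃ q : MG1.State M₀ M₁ → ℝ, MG1.IsStationary (D.trunc N).P q) ∧
    (∀ᶠ N : ℕ in atTop, ∃! q : MG1.State M₀ M₁ → ℝ, MG1.IsStationary (D.trunc N).P q) ∧
    ∀ (p : MG1.State M₀ M₁ → ℝ) (q : ℕ → MG1.State M₀ M₁ → ℝ),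
      MG1.IsStationary D.P p →
      (∀ N : ℕ, 1 ≤ N → MG1.IsStationary (D.trunc N).P (q N)) →
      ∀ k : ℕ,
        (∀ i : MG1.Phase M₀ M₁ k,
          Tendsto (fun N : ℕ => (MG1.level (q N) k i - MG1.level p k i) / (1 - F N)) atTop
            (𝓝 (MG1.limitConst (D.drift ϖ) p cA cB * MG1.level p k i)) ∧
          0 < MG1.limitConst (D.drift ϖ) p cA cB * MG1.level p k i) ∧
        Tendsto
          (fun N : ℕ => 1 / (1 - F N) *
            MG1.tvNorm (fun i : MG1.Phase M₀ M₁ k =>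
              (MG1.level (q N) k i - MG1.level p k i) / ∑ j, MG1.level p k j))
          atTop (𝓝 (MG1.limitConst (D.drift ϖ) p cA cB)) ∧
        0 < MG1.limitConst (D.drift ϖ) p cA cB := by
  have hreach := MG1.transGen_step_of_isIrreducible hD.irreducible
  have α : MG1.State M₀ M₁ := MG1.zeroState ⟨0, hM₀⟩
  refine ⟨?_, fun N hN => ?_, ?_, fun p q hp hq k => ?_⟩
  · obtain ⟨p, hp⟩ := hD.exists_isStationary hM₀ hM₁
    exact ⟨p, hp, fun p' hp' => hp'.unique hD.stochastic (fun z => hreach z α) hp⟩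
  · obtain ⟨N, rfl⟩ : ∃ m, N = m + 1 := ⟨N - 1, by omega⟩
    exact hD.exists_isStationary_trunc hM₀ hM₁ N
  · obtain ⟨n, hn⟩ := eventually_atTop.1 (hD.eventually_reach_trunc hM₁ α)
    filter_upwards [eventually_ge_atTop (n + 1)] with N hN
    obtain ⟨N, rfl⟩ : ∃ m, N = m + 1 := ⟨N - 1, by omega⟩
    obtain ⟨q, hq⟩ := hD.exists_isStationary_trunc hM₀ hM₁ N
    exact ⟨q, hq, fun q' hq' => hq'.unique (MG1.isStochastic_trunc hD.stochastic N)
      (hn N (by omega)) hq⟩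
  · have hpos := hp.pos hD.stochastic hreach
    have hc := MG1.limitConst_pos hD hF hp
    have hlim : ∀ i : MG1.Phase M₀ M₁ k,
        Tendsto (fun N : ℕ => (MG1.level (q N) k i - MG1.level p k i) / (1 - F N)) atTop
          (𝓝 (MG1.limitConst (D.drift ϖ) p cA cB * MG1.level p k i)) := fun i =>
      (tendsto_add_atTop_iff_nat 1).1 (MG1.tendsto_scaled_difference hD hF hM₁ hp
        (q := fun N => q (N + 1)) (fun N => hq (N + 1) (by omega)) ⟨k, i⟩)
    refine ⟨fun i => ⟨hlim i, mul_pos hc (hpos _)⟩, ?_, hc⟩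
    have : Nonempty (MG1.Phase M₀ M₁ k) := by
      cases k with
      | zero => exact ⟨(⟨0, hM₀⟩ : Fin M₀)⟩
      | succ k => exact ⟨(⟨0, hM₁⟩ : Fin M₁)⟩
    have hs : 0 < ∑ j, MG1.level p k j :=
      Finset.sum_pos (fun j _ => hpos ⟨k, j⟩) Finset.univ_nonempty
    have h1 := (tendsto_finsetSum Finset.univ fun i (_ : i ∈ Finset.univ) =>
      (hlim i).abs).div_const (∑ j, MG1.level p k j)
    have h2 : (∑ i, |MG1.limitConst (D.drift ϖ) p cA cB * MG1.level p k i|)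
        / ∑ j, MG1.level p k j = MG1.limitConst (D.drift ϖ) p cA cB := by
      rw [Finset.sum_congr rfl fun i _ =>
        abs_of_pos (mul_pos hc (show 0 < MG1.level p k i from hpos ⟨k, i⟩)),
        ← Finset.mul_sum, mul_div_cancel_right₀ _ hs.ne']
    rw [h2] at h1
    refine h1.congr fun N => ?_
    have hG := hF.longTailed.tail_pos N
    simp only [MG1.tvNorm, abs_div, abs_of_pos hs, abs_of_pos hG, ← Finset.sum_div]
    ring
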